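/- \textbf{Definitions.} Let $r\in\{0,1,2,\dots,\infty,\omega\}$ and $d\ge 1$. A \emph{g-GIET} (generalized interval exchange transformation with gaps) is a map $T:I^t\to I^b$ with $I^t=\bigsqcup_{\alpha}[a_\alpha,b_\alpha)\subset[0,1)$ and $I^b=\bigsqcup_{\alpha}[a'_\alpha,b'_\alpha)\subset[0,1)$, disjoint unions of $d$ non-empty right-open intervals, such that for each $\alpha$ the restriction of $T$ to $[a_\alpha,b_\alpha)$ is an increasing bijection onto $[a'_\alpha,b'_\alpha)$ that extends to a $C^r$-diffeomorphism $[a_\alpha,b_\alpha]\to[a'_\alpha,b'_\alpha]$ (a homeomorphism if $r=0$). It is a \emph{GIET} if $I^t=I^b=[0,1)$. The \emph{restriction} of $T$ to a finite union $J\subset I^t$ of right-open intervals is the map $T|_J:J\to T(J)$, again with top domain $J$ and bottom domain $T(J)$. For such a map $T:I^t\to I^b$, the orbit $\mathcal O(x)$ of $x$ consists of $x$ and of all $T^n(x)$, $T^{-n}(x)$, $n\ge1$, that are defined. It is \emph{periodic} if it is finite and contained in $I^t\cap I^b$; its period is its number of points. It is \emph{transient} if $T^n(x)\notin I^t$ for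 some $n\ge 0$ for which $T^n(x)$ is defined, and $T^{-m}(x)\notin I^b$ for some $m\ge0$ for which $T^{-m}(x)$ is defined. It is \emph{recurrent} if it is contained in $I^t\cap I^b$ and $x$ is an accumulation point both of the sequence $(T^n(x))_{n\ge0}$ and of the sequence $(T^{-n}(x))_{n\ge0}$ (so periodic orbits are recurrent), and \emph{non-trivially recurrent} if it is recurrent and not periodic. A \emph{quasiminimal} is the closure in $I^t$ of a non-trivially recurrent orbit. Let $\overline T$ be the map obtained by replacing the intervals $[a,b)$ of continuity of $T$ by $(a,b]$ and extending $T$ to the points $b$ by left limits. A \emph{periodic orbit at a right endpoint} of $T$ is a periodic orbit of $\overline T$ that contains the right endpoint $b$ of one of these intervals; a periodic orbit at a left endpoint is a periodic orbit of $T$ that contains a left endpoint. A finite union $J$ of right-open intervals is a \emph{domain of transition} if the orbit under $T|_J$ of every $x\in J$ is transient, and a \emph{domain of recurrence} if the orbit under $T|_J$ of no $x\in J$ is transient. \textbf{Theorem (Decomposition theorem).} For every GIET $T:[0,1)\to[0,1)$ there exist $k\ge 0$ and a partition $$[0,1)=D\sqcup R_1\sqcup\dots\sqcup R_k$$ into finite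 unions of right-open intervals ($D$ possibly empty) such that $D$ is a domain of transition, each $R_i$ is a domain of recurrence, and for each $i$ exactly one of the following holds for the restriction $T|_{R_i}$: \begin{enumerate} \item (periodic domain) there is $p\ge1$ such that $T|_{R_i}$ has a periodic orbit of period $p$, possibly at a (left or right) endpoint, and all recurrent orbits of $T|_{R_i}$ are periodic of period $p$; \item (quasiminimal domain) $T|_{R_i}$ has a unique quasiminimal, and all recurrent orbits of $T|_{R_i}$ are non-trivially recurrent. \end{enumerate} -/

import Mathlib

open Set Filter Topology Function

/-- A partially defined map of the real line: `toFun` is only meaningful on `dom`. -/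
structure PMap where
  dom : Set ℝ
  toFun : ℝ → ℝ

namespace PMap

/-- The image of the map; for a g-GIET this is `I^b`, and `dom` is `I^t`. -/
def range (T : PMap) : Set ℝ := T.toFun '' T.dom

/-- The restriction `T|_J : J → T(J)`. -/
def restrict (T : PMap) (J : Set ℝ) : PMap := ⟨T.dom ∩ J, T.toFun⟩

/-- The domain of definition of the `n`-th iterate. -/
def domIter (T : PMap) (n : ℕ) : Set ℝ := {x | ∀ k < n, T.toFun^[k] x ∈ T.dom}

def forwardOrbit (T : PMap) (x : ℝ) : Set ℝ :=
  {y | ∃ n, x ∈ T.domIter n ∧ T.toFun^[n] x = y}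

/-- The points `y = T^{-n}(x)`, `n ≥ 0`, for an injective map. -/
def backwardOrbit (T : PMap) (x : ℝ) : Set ℝ :=
  {y | ∃ n, y ∈ T.domIter n ∧ T.toFun^[n] y = x}

def orbit (T : PMap) (x : ℝ) : Set ℝ := T.forwardOrbit x ∪ T.backwardOrbit x

/-- A periodic orbit: a finite orbit contained in `I^t ∩ I^b`. -/
def IsPeriodic (T : PMap) (x : ℝ) : Prop :=
  T.orbit x ⊆ T.dom ∩ T.range ∧ (T.orbit x).Finite

/-- The orbit of `x` is periodic, of (least) period `p`. -/
def IsPeriodicOfPeriod (T : PMap) (p : ℕ) (x : ℝ) : Prop :=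
  T.IsPeriodic x ∧ (T.orbit x).ncard = p

/-- The orbit of `x` escapes in the future into a top gap (the complement of `dom`) and in the
past into a bottom gap (the complement of `range`). -/
def IsTransient (T : PMap) (x : ℝ) : Prop :=
  (∃ n, x ∈ T.domIter n ∧ T.toFun^[n] x ∉ T.dom) ∧
  (∃ n y, y ∈ T.domIter n ∧ T.toFun^[n] y = x ∧ y ∉ T.range)

/-- Accumulation points in `I^t` of the sequence `T^n(x)`, `n → ∞`. On infinite orbits of an
injective map they are the accumulation points of the set `forwardOrbit`; a periodic orbit is
its own limit set. -/
def omegaLimit (T : PMap) (x : ℝ) : Set ℝ :=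
  {y | y ∈ T.dom ∧ ∀ U ∈ 𝓝 y, ∀ N : ℕ, ∃ n ≥ N, x ∈ T.domIter n ∧ T.toFun^[n] x ∈ U}

/-- Accumulation points in `I^t` of the sequence `T^{-n}(x)`, `n → ∞`. -/
def alphaLimit (T : PMap) (x : ℝ) : Set ℝ :=
  {y | y ∈ T.dom ∧ ∀ U ∈ 𝓝 y, ∀ N : ℕ, ∃ n ≥ N, ∃ z ∈ U, z ∈ T.domIter n ∧ T.toFun^[n] z = x}

/-- The orbit of `x` is recurrent, both in the future and in the past. -/
def IsRecurrent (T : PMap) (x : ℝ) : Prop :=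
  (T.forwardOrbit x ⊆ T.dom ∩ T.range ∧ x ∈ T.omegaLimit x) ∧
  (T.backwardOrbit x ⊆ T.dom ∩ T.range ∧ x ∈ T.alphaLimit x)

def IsNontriviallyRecurrent (T : PMap) (x : ℝ) : Prop := T.IsRecurrent x ∧ ¬ T.IsPeriodic x

/-- A quasiminimal: the closure in `I^t` of a non-trivially recurrent orbit. -/
def IsQuasiminimal (T : PMap) (Ω : Set ℝ) : Prop :=
  ∃ x, T.IsNontriviallyRecurrent x ∧ Ω = T.dom ∩ closure (T.orbit x)

/-- The left-open version of `T`: if `dom` is the union of intervals `[a, b)`, then the new domain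
is the union of the intervals `(a, b]`, and the map is extended by continuity from the left. -/
noncomputable def leftOpen (T : PMap) : PMap :=
  ⟨{y | ∀ᶠ z in 𝓝[<] y, z ∈ T.dom}, leftLim T.toFun⟩

/-- `y` is the right endpoint of an interval of continuity of `T`. -/
def IsRightEndpoint (T : PMap) (y : ℝ) : Prop :=
  y ∈ T.leftOpen.dom ∧ ¬ (T.dom ∈ 𝓝 y ∧ ContinuousAt T.toFun y)

/-- `y` lies on a periodic orbit, of period `p`, at a right endpoint of `T`. -/
def IsPeriodicAtRightEndpoint (T : PMap) (p : ℕ) (y : ℝ) : Prop :=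
  T.leftOpen.IsPeriodicOfPeriod p y ∧ ∃ z ∈ T.leftOpen.orbit y, T.IsRightEndpoint z

/-- There is a periodic orbit, possibly at an endpoint (periodic orbits at left endpoints are
periodic orbits of `T` itself), and all recurrent orbits are periodic of the same period. -/
def IsPeriodicType (T : PMap) : Prop :=
  ∃ p : ℕ, ((∃ x, T.IsPeriodicOfPeriod p x) ∨ (∃ y, T.IsPeriodicAtRightEndpoint p y)) ∧
    ∀ x, T.IsRecurrent x → T.IsPeriodicOfPeriod p x

/-- There is a unique quasiminimal and all recurrent orbits are non-trivially recurrent. -/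
def IsQuasiminimalType (T : PMap) : Prop :=
  (∃! Ω, T.IsQuasiminimal Ω) ∧ ∀ x, T.IsRecurrent x → T.IsNontriviallyRecurrent x

/-- Every orbit of the restriction of `T` to `J` is transient. -/
def IsDomainOfTransition (T : PMap) (J : Set ℝ) : Prop :=
  ∀ x ∈ J, (T.restrict J).IsTransient x

/-- No orbit of the restriction of `T` to `J` is transient. -/
def IsDomainOfRecurrence (T : PMap) (J : Set ℝ) : Prop :=
  ∀ x ∈ J, ¬ (T.restrict J).IsTransient x

end PMap

/-- A `C^r` generalized interval exchange transformation with gaps, of `d` intervals: the top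
interval `[topL α, topR α)` is mapped onto the bottom interval `[botL α, botR α)` by an
orientation preserving `C^r` diffeomorphism `g` which extends to the closures (with inverse `h`). -/
structure GGIET (r : WithTop ℕ∞) (d : ℕ) where
  topL : Fin d → ℝ
  topR : Fin d → ℝ
  botL : Fin d → ℝ
  botR : Fin d → ℝ
  toFun : ℝ → ℝ
  top_lt : ∀ α, topL α < topR α
  bot_lt : ∀ α, botL α < botR α
  top_subset : ∀ α, Ico (topL α) (topR α) ⊆ Ico 0 1
  bot_subset : ∀ α, Ico (botL α) (botR α) ⊆ Ico 0 1
  top_disjoint : Pairwise fun α β => Disjoint (Ico (topL α) (topR α)) (Ico (topL β) (topR β))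
  bot_disjoint : Pairwise fun α β => Disjoint (Ico (botL α) (botR α)) (Ico (botL β) (botR β))
  branch : ∀ α, ∃ g h : ℝ → ℝ,
    MapsTo g (Icc (topL α) (topR α)) (Icc (botL α) (botR α)) ∧
    MapsTo h (Icc (botL α) (botR α)) (Icc (topL α) (topR α)) ∧
    InvOn h g (Icc (topL α) (topR α)) (Icc (botL α) (botR α)) ∧
    StrictMonoOn g (Icc (topL α) (topR α)) ∧
    ContDiffOn ℝ r g (Icc (topL α) (topR α)) ∧
    ContDiffOn ℝ r h (Icc (botL α) (botR α)) ∧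
    EqOn toFun g (Ico (topL α) (topR α))

namespace GGIET

/-- The domain `I^t`. -/
def top {r : WithTop ℕ∞} {d : ℕ} (T : GGIET r d) : Set ℝ := ⋃ α, Ico (T.topL α) (T.topR α)

/-- The image `I^b`. -/
def bot {r : WithTop ℕ∞} {d : ℕ} (T : GGIET r d) : Set ℝ := ⋃ α, Ico (T.botL α) (T.botR α)

/-- A generalized interval exchange transformation: a g-GIET without gaps. -/
def IsGIET {r : WithTop ℕ∞} {d : ℕ} (T : GGIET r d) : Prop :=
  T.top = Ico 0 1 ∧ T.bot = Ico 0 1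

def toPMap {r : WithTop ℕ∞} {d : ℕ} (T : GGIET r d) : PMap := ⟨T.top, T.toFun⟩

end GGIET

/-- A finite union of right-open intervals. -/
def IsRightOpenUnion (S : Set ℝ) : Prop :=
  ∃ s : Finset (ℝ × ℝ), S = ⋃ q ∈ s, Ico q.1 q.2

/-! Split every interior point of `[0, 1)` into a left and a right copy. The resulting double arrow
space `DArrow` is a compact linear order. A GIET induces on it a homeomorphism `hat`, increasing on
finitely many clopen intervals: right points carry `T`, left points carry its left limits. Clopen
sets trace finite unions of right-open intervals on the right points (`isRightOpenUnion_real`), so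
it suffices to decompose the compact space into clopen sets.

By compactness every future or past limit set contains a minimal set. It therefore meets one of the
pairwise disjoint classes: the points of minimal period `q`, or an aperiodic minimal set. The key
notion is `IsRegion T R C`: each point of the clopen set `R` stays in `R` in at least one time
direction and accumulates there only on the class `C`. Such a set contains no transient orbit.

Regions exist around every point of every class. Near a periodic point, `T^q` or its inverse maps a
small clopen interval into itself, and monotonicity makes orbits there accumulate only on points of
period `q` (`exists_isRegion_of_periodic`). For an aperiodic minimal set `M`, all but finitely many
gaps of `M` are mapped to gaps. From the convex hull of `M` one removes the finitely many gaps whose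
orbits meet exceptional gaps in both time directions; a remaining gap wanders freely in the future
or in the past and accumulates on `M` (`IsMinimalSet.exists_isRegion`). Finitely many regions catch
all orbits in both directions. They can be made disjoint, since an orbit accumulating on one class
cannot enter a region of another, and their complement is the domain of transition
(`exists_disjoint_regions`).

On the real line a point may return near itself from the side opposite to its right copy, so
recurrence in `[0, 1)` only shows that one of the two copies is a limit point. For periodic domains
`exists_iterate_eq` rules out a return through the left copy alone. For quasiminimal domains
`FollowsLeft` shows that a left copy lying in `M` has the same real orbit as its right twin. -/

namespace Homeomorph

/-! ### Limit sets of homeomorphisms. -/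

variable {X : Type*} [TopologicalSpace X]

/-- The set of cluster points of the forward orbit of `x`. The backward limit set is
`T.symm.omegaSet x`. -/
def omegaSet (T : X ≃ₜ X) (x : X) : Set X := {w | MapClusterPt w atTop fun n : ℕ => T^[n] x}

variable {T : X ≃ₜ X} {x w : X} {R R' C M : Set X}

theorem mem_omegaSet_iff :
    w ∈ T.omegaSet x ↔ ∀ U ∈ 𝓝 w, ∀ N : ℕ, ∃ n ≥ N, T^[n] x ∈ U := by
  simp only [omegaSet, mem_ofPred_eq, mapClusterPt_iff_frequently, frequently_atTop]

theorem symm_iterate_iterate (T : X ≃ₜ X) (n : ℕ) (x : X) : T.symm^[n] (T^[n] x) = x :=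
  (LeftInverse.iterate (g := T.symm) (f := T) T.symm_apply_apply n) x

theorem iterate_symm_iterate (T : X ≃ₜ X) (n : ℕ) (x : X) : T^[n] (T.symm^[n] x) = x :=
  (LeftInverse.iterate (g := T) (f := T.symm) T.apply_symm_apply n) x

theorem iterate_symm_iterate_of_le (T : X ≃ₜ X) {m n : ℕ} (h : m ≤ n) (x : X) :
    T^[n] (T.symm^[m] x) = T^[n - m] x := by
  obtain ⟨k, rfl⟩ := Nat.exists_eq_add_of_le' h
  rw [iterate_add_apply, iterate_symm_iterate, Nat.add_sub_cancel]

theorem iterate_symm_iterate_of_ge (T : X ≃ₜ X) {m n : ℕ} (h : n ≤ m) (x : X) :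
    T^[n] (T.symm^[m] x) = T.symm^[m - n] x := by
  obtain ⟨k, rfl⟩ := Nat.exists_eq_add_of_le h
  rw [iterate_add_apply, iterate_symm_iterate, Nat.add_sub_cancel_left]

theorem isClosed_omegaSet : IsClosed (T.omegaSet x) := isClosed_setOfPred_clusterPt

theorem omegaSet_nonempty [CompactSpace X] : (T.omegaSet x).Nonempty :=
  exists_clusterPt_of_compactSpace _

theorem apply_mem_omegaSet (h : w ∈ T.omegaSet x) : T w ∈ T.omegaSet x := by
  rw [mem_omegaSet_iff] at h ⊢
  intro U hU N
  obtain ⟨n, hn, hx⟩ := h _ (T.continuous.continuousAt hU) N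
  exact ⟨n + 1, by omega, by rw [iterate_succ_apply']; exact hx⟩

theorem symm_apply_mem_omegaSet (h : w ∈ T.omegaSet x) : T.symm w ∈ T.omegaSet x := by
  rw [mem_omegaSet_iff] at h ⊢
  intro U hU N
  obtain ⟨n, hn, hx⟩ := h _ (T.symm.continuous.continuousAt hU) (N + 1)
  obtain ⟨n, rfl⟩ := Nat.exists_eq_add_of_le' (show 1 ≤ n by omega)
  refine ⟨n, by omega, ?_⟩
  rwa [mem_preimage, iterate_succ_apply', T.symm_apply_apply] at hx

theorem iterate_mem_omegaSet (h : w ∈ T.omegaSet x) (n : ℕ) : T^[n] w ∈ T.omegaSet x := by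
  induction n with
  | zero => exact h
  | succ n ih => rw [iterate_succ_apply']; exact apply_mem_omegaSet ih

theorem symm_iterate_mem_omegaSet (h : w ∈ T.omegaSet x) (n : ℕ) :
    T.symm^[n] w ∈ T.omegaSet x := by
  induction n with
  | zero => exact h
  | succ n ih => rw [iterate_succ_apply']; exact symm_apply_mem_omegaSet ih

theorem omegaSet_iterate (T : X ≃ₜ X) (k : ℕ) (x : X) :
    T.omegaSet (T^[k] x) = T.omegaSet x := by
  ext w
  simp only [mem_omegaSet_iff, ← iterate_add_apply]
  constructor
  · intro h U hU N
    obtain ⟨n, hn, hx⟩ := h U hU N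
    exact ⟨n + k, by omega, hx⟩
  · intro h U hU N
    obtain ⟨n, hn, hx⟩ := h U hU (N + k)
    exact ⟨n - k, by omega, by rwa [Nat.sub_add_cancel (by omega)]⟩

theorem omegaSet_subset_of_forall_mem (hC : IsClosed C) (h : ∀ n, T^[n] x ∈ C) :
    T.omegaSet x ⊆ C := fun w hw => by
  by_contra hwC
  obtain ⟨n, -, hn⟩ := mem_omegaSet_iff.1 hw _ (hC.isOpen_compl.mem_nhds hwC) 0
  exact hn (h n)

theorem mem_omegaSet_of_periodic {q : ℕ} (hq : 0 < q) (h : IsPeriodicPt T q x) :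
    x ∈ T.omegaSet x := by
  rw [mem_omegaSet_iff]
  intro U hU N
  exact ⟨q * N, Nat.le_mul_of_pos_left N hq, by
    rw [(h.mul_const N).eq]; exact mem_of_mem_nhds hU⟩

theorem isPeriodicPt_symm {q : ℕ} : IsPeriodicPt T.symm q x ↔ IsPeriodicPt T q x := by
  constructor <;> intro h
  · have := iterate_symm_iterate T q x
    rwa [h.eq] at this
  · have := symm_iterate_iterate T q x
    rwa [h.eq] at this

theorem minimalPeriod_symm : minimalPeriod T.symm x = minimalPeriod T x :=
  Nat.dvd_antisymm
    (isPeriodicPt_iff_minimalPeriod_dvd.1 (isPeriodicPt_symm.2 (isPeriodicPt_minimalPeriod T x)))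
    (isPeriodicPt_iff_minimalPeriod_dvd.1
      (isPeriodicPt_symm.1 (isPeriodicPt_minimalPeriod T.symm x)))

/-- Points of a periodic orbit are recovered as forward images. -/
theorem symm_iterate_eq_of_periodic {q n : ℕ} (hn : n ≤ q) (h : IsPeriodicPt T q x) :
    T.symm^[n] x = T^[q - n] x := by
  have := iterate_symm_iterate_of_ge T.symm (m := q) (n := n) hn x
  rw [symm_symm, h.eq] at this
  exact this

theorem iterate_injective_of_notMem_periodicPts (hx : x ∉ periodicPts T) :
    Injective fun n => T^[n] x := by
  intro m n hmn
  have key : ∀ {m n : ℕ}, T^[m] x = T^[n] x → ¬ m < n := fun {m n} h hlt =>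
    hx ⟨n - m, Nat.sub_pos_of_lt hlt, iterate_cancel T.injective h.symm⟩
  exact le_antisymm (not_lt.1 (key hmn.symm)) (not_lt.1 (key hmn))

theorem iterate_mul_mem {q : ℕ} {N : Set X} (hmap : MapsTo T^[q] N N) (hx : x ∈ N) (k : ℕ) :
    T^[q * k] x ∈ N := by
  rw [iterate_mul]
  exact hmap.iterate k hx

theorem omegaSet_subset_of_periodic [T2Space X] {q : ℕ} (hq : 0 < q) (hx : minimalPeriod T x = q) :
    T.omegaSet x ⊆ {y | minimalPeriod T y = q} := by
  have hper : x ∈ periodicPts T := minimalPeriod_pos_iff_mem_periodicPts.1 (hx ▸ hq)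
  have hsub : T.omegaSet x ⊆ (fun n => T^[n] x) '' Iio q := by
    refine omegaSet_subset_of_forall_mem ((finite_Iio q).image _).isClosed fun n => ?_
    exact ⟨n % q, Nat.mod_lt n hq, by rw [← hx]; exact iterate_mod_minimalPeriod_eq⟩
  intro y hy
  obtain ⟨n, -, rfl⟩ := hsub hy
  exact (minimalPeriod_apply_iterate hper n).trans hx

/-! ### Minimal sets -/

/-- A nonempty closed set which is minimal among those mapped into themselves. -/
structure IsMinimalSet (T : X ≃ₜ X) (M : Set X) : Prop where
  nonempty : M.Nonempty
  isClosed : IsClosed M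
  mapsTo : MapsTo T M M
  eq_of_subset : ∀ A ⊆ M, A.Nonempty → IsClosed A → MapsTo T A A → A = M

theorem exists_isMinimalSet_subset [CompactSpace X] {A : Set X} (hne : A.Nonempty)
    (hcl : IsClosed A) (hA : MapsTo T A A) : ∃ M ⊆ A, IsMinimalSet T M := by
  obtain ⟨M, hMA, hM⟩ := zorn_superset_nonempty
    {B : Set X | B.Nonempty ∧ IsClosed B ∧ MapsTo T B B} (by
      intro c hc hchain hcne
      refine ⟨⋂₀ c, ⟨?_, isClosed_sInter fun B hB => (hc hB).2.1, ?_⟩, fun s hs =>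
        sInter_subset_of_mem hs⟩
      · have := hcne.to_subtype
        refine IsCompact.nonempty_sInter_of_directed_nonempty_isCompact_isClosed ?_
          (fun B hB => (hc hB).1) (fun B hB => (hc hB).2.1.isCompact) (fun B hB => (hc hB).2.1)
        intro A hA B hB
        rcases hchain.total hA hB with h | h
        · exact ⟨A, hA, Subset.rfl, h⟩
        · exact ⟨B, hB, h, Subset.rfl⟩
      · intro x hx B hB
        exact (hc hB).2.2 (hx B hB)) A ⟨hne, hcl, hA⟩
  refine ⟨M, hMA, hM.prop.1, hM.prop.2.1, hM.prop.2.2, fun B hB h1 h2 h3 => ?_⟩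
  exact hB.antisymm (hM.le_of_le ⟨h1, h2, h3⟩ hB)

namespace IsMinimalSet

theorem omegaSet_eq [CompactSpace X] (hM : IsMinimalSet T M) (hx : x ∈ M) : T.omegaSet x = M :=
  hM.eq_of_subset _ (omegaSet_subset_of_forall_mem hM.isClosed fun n => hM.mapsTo.iterate n hx)
    omegaSet_nonempty isClosed_omegaSet fun _ hw => apply_mem_omegaSet hw

/-- Minimality assumes forward invariance only. Backward invariance holds because `M` is the limit
set of each of its points, and limit sets are invariant under the inverse. -/
theorem symm_mapsTo [CompactSpace X] (hM : IsMinimalSet T M) : MapsTo T.symm M M := by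
  intro x hx
  have := hM.omegaSet_eq hx
  rw [← this] at hx ⊢
  exact symm_apply_mem_omegaSet hx

theorem symm [CompactSpace X] (hM : IsMinimalSet T M) : IsMinimalSet T.symm M where
  nonempty := hM.nonempty
  isClosed := hM.isClosed
  mapsTo := hM.symm_mapsTo
  eq_of_subset := by
    intro A hAM hne hcl hA
    obtain ⟨x, hx⟩ := hne
    have h1 : T.symm.omegaSet x ⊆ A := omegaSet_subset_of_forall_mem hcl fun n => hA.iterate n hx
    have h2 : T.symm.omegaSet x = M := hM.eq_of_subset _ (h1.trans hAM) omegaSet_nonempty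
      isClosed_omegaSet fun w hw => symm_apply_mem_omegaSet (T := T.symm) hw
    exact hAM.antisymm (h2 ▸ h1)

theorem eq_of_inter_nonempty [CompactSpace X] {M' : Set X} (hM : IsMinimalSet T M)
    (hM' : IsMinimalSet T M') (h : (M ∩ M').Nonempty) : M = M' := by
  obtain ⟨x, hx, hx'⟩ := h
  rw [← hM.omegaSet_eq hx, hM'.omegaSet_eq hx']

/-- Aperiodic recurrence excludes isolated points of `M`. Applied to open rays, this decides on
which side a point of `M` is accumulated. -/
theorem exists_ne_mem [CompactSpace X] (hM : IsMinimalSet T M)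
    (hap : ∀ x ∈ M, x ∉ periodicPts T) {U : Set X} (hx : x ∈ M) (hU : U ∈ 𝓝 x) :
    ∃ y ∈ U ∩ M, y ≠ x := by
  have h : x ∈ T.omegaSet x := by rwa [hM.omegaSet_eq hx]
  obtain ⟨n, hn, hxn⟩ := mem_omegaSet_iff.1 h U hU 1
  exact ⟨_, ⟨hxn, hM.mapsTo.iterate n hx⟩, fun he => hap x hx ⟨n, hn, he⟩⟩

end IsMinimalSet

theorem IsMinimalSet.aperiodic_symm (hap : ∀ x ∈ M, x ∉ periodicPts T) :
    ∀ x ∈ M, x ∉ periodicPts T.symm := fun x hx ⟨n, hn, h⟩ =>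
  hap x hx ⟨n, hn, isPeriodicPt_symm.1 h⟩

/-- The aperiodic minimal sets. -/
def IsAperiodicMinimal (T : X ≃ₜ X) (M : Set X) : Prop :=
  IsMinimalSet T M ∧ ∀ x ∈ M, x ∉ periodicPts T

/-- A minimal subset of the limit set either is aperiodic, hence itself a class, or contains a
periodic point. -/
theorem exists_class_inter_omegaSet [CompactSpace X] (T : X ≃ₜ X) (x : X) :
    ∃ C, ((∃ q > 0, C = {y | minimalPeriod T y = q}) ∨ IsAperiodicMinimal T C) ∧
      (T.omegaSet x ∩ C).Nonempty := by
  obtain ⟨M, hMx, hM⟩ := exists_isMinimalSet_subset (T := T) (A := T.omegaSet x)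
    omegaSet_nonempty isClosed_omegaSet fun _ => apply_mem_omegaSet
  by_cases hap : ∀ y ∈ M, y ∉ periodicPts T
  · obtain ⟨y, hy⟩ := hM.nonempty
    exact ⟨M, Or.inr ⟨hM, hap⟩, y, hMx hy, hy⟩
  · push Not at hap
    obtain ⟨y, hy, hper⟩ := hap
    exact ⟨_, Or.inl ⟨_, minimalPeriod_pos_of_mem_periodicPts hper, rfl⟩, y, hMx hy, rfl⟩

/-! ### Recurrent regions -/

/-- A clopen set each of whose points stays in it for all positive or for all negative times, and
accumulates in that time direction only on `C`. -/
structure IsRegion (T : X ≃ₜ X) (R C : Set X) : Prop where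
  isClopen : IsClopen R
  stays : ∀ x ∈ R, ((∀ n, T^[n] x ∈ R) ∧ T.omegaSet x ⊆ C) ∨
    ((∀ n, T.symm^[n] x ∈ R) ∧ T.symm.omegaSet x ⊆ C)

theorem IsRegion.symm (h : IsRegion T R C) : IsRegion T.symm R C :=
  ⟨h.isClopen, fun x hx => (h.stays x hx).symm⟩

theorem IsRegion.biUnion {ι : Type*} {s : Set ι} (hs : s.Finite) {R : ι → Set X}
    (h : ∀ i ∈ s, IsRegion T (R i) C) : IsRegion T (⋃ i ∈ s, R i) C where
  isClopen := hs.isClopen_biUnion fun i hi => (h i hi).isClopen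
  stays := by
    intro x hx
    obtain ⟨i, hi, hxi⟩ := mem_iUnion₂.1 hx
    refine ((h i hi).stays x hxi).imp ?_ ?_ <;>
    exact fun h' => ⟨fun n => mem_biUnion hi (h'.1 n), h'.2⟩

/-- Points of `R` which stay in `R` for positive times never meet a region of another class. -/
theorem IsRegion.forall_iterate_notMem [CompactSpace X] {C' : Set X} (h' : IsRegion T R' C')
    (hCC : Disjoint C C') (hx : x ∉ R') (hω : T.omegaSet x ⊆ C) (n : ℕ) : T^[n] x ∉ R' := by
  intro hn
  -- If the orbit stays in `R'` in the future, its nonempty limit set lies in both classes. If it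
  -- stays in the past, going back `n` steps puts `x` in `R'`.
  rcases h'.stays _ hn with ⟨-, h2⟩ | ⟨h1, -⟩
  · rw [omegaSet_iterate] at h2
    obtain ⟨w, hw⟩ := omegaSet_nonempty (T := T) (x := x)
    exact hCC.le_bot ⟨hω hw, h2 hw⟩
  · have := h1 n
    rw [symm_iterate_iterate] at this
    exact hx this

/-- In the time direction in which a point stays in `R`, it never enters a region of another class,
so removing such regions does not disturb it. -/
theorem IsRegion.diff_biUnion [CompactSpace X] {ι : Type*} {s : Set ι} (hs : s.Finite)
    {R' C' : ι → Set X} (h : IsRegion T R C) (h' : ∀ i ∈ s, IsRegion T (R' i) (C' i))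
    (hCC : ∀ i ∈ s, Disjoint C (C' i)) : IsRegion T (R \ ⋃ i ∈ s, R' i) C where
  isClopen := h.isClopen.diff (hs.isClopen_biUnion fun i hi => (h' i hi).isClopen)
  stays := by
    rintro x ⟨hx, hx'⟩
    simp only [mem_iUnion, not_exists] at hx'
    refine (h.stays x hx).imp ?_ ?_
    · refine fun h1 => ⟨fun n => ⟨h1.1 n, ?_⟩, h1.2⟩
      simp only [mem_iUnion, not_exists]
      exact fun i hi => (h' i hi).forall_iterate_notMem (hCC i hi) (hx' i hi) h1.2 n
    · refine fun h1 => ⟨fun n => ⟨h1.1 n, ?_⟩, h1.2⟩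
      simp only [mem_iUnion, not_exists]
      exact fun i hi => (h' i hi).symm.forall_iterate_notMem (hCC i hi) (hx' i hi) h1.2 n

/-- Finitely many points have regions which together catch every orbit. -/
theorem exists_finset_regions_of_omegaSet [CompactSpace X] (T : X ≃ₜ X) (Q : Set (Set X × Set X))
    (hopen : ∀ q ∈ Q, IsOpen q.2)
    (hω : ∀ x, ∃ q ∈ Q, (T.omegaSet x ∩ q.2).Nonempty) :
    ∃ t : Finset (Set X × Set X), (∀ q ∈ t, q ∈ Q) ∧ ∀ x, ∃ q ∈ t, ∃ n, T^[n] x ∈ q.2 := by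
  classical
  have key : ∀ x, ∃ q ∈ Q, ∃ n, T^[n] x ∈ q.2 := by
    intro x
    obtain ⟨q, hq, w, hw, hwq⟩ := hω x
    obtain ⟨n, -, hn⟩ := mem_omegaSet_iff.1 hw _ ((hopen q hq).mem_nhds hwq) 0
    exact ⟨q, hq, n, hn⟩
  choose q hq n hn using key
  obtain ⟨t, ht⟩ := isCompact_univ.elim_finite_subcover (fun x => T^[n x] ⁻¹' (q x).2)
    (fun x => (hopen _ (hq x)).preimage (T.continuous.iterate _))
    (fun x _ => mem_iUnion.2 ⟨x, hn x⟩)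
  refine ⟨t.image q, fun p hp => ?_, fun x => ?_⟩
  · obtain ⟨y, -, rfl⟩ := Finset.mem_image.1 hp
    exact hq y
  · obtain ⟨y, hy, hxy⟩ := mem_iUnion₂.1 (ht (mem_univ x))
    exact ⟨q y, Finset.mem_image_of_mem q hy, n y, hxy⟩

/-- If every limit set meets one of the disjoint classes `𝒞`, and the points of these have regions,
then finitely many disjoint regions catch every orbit, in the future and in the past. -/
theorem exists_disjoint_regions [CompactSpace X] (T : X ≃ₜ X) (𝒞 : Set (Set X))
    (B : Set X → Set X) (hdisj : 𝒞.PairwiseDisjoint id)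
    (hω : ∀ x, ∃ C ∈ 𝒞, (T.omegaSet x ∩ C).Nonempty)
    (hα : ∀ x, ∃ C ∈ 𝒞, (T.symm.omegaSet x ∩ C).Nonempty)
    (hC : ∀ C ∈ 𝒞, ∀ x ∈ C, T.omegaSet x ⊆ C ∧ T.symm.omegaSet x ⊆ C)
    (hR : ∀ C ∈ 𝒞, ∀ p ∈ C, ∃ R, p ∈ R ∧ R ⊆ B C ∧ IsRegion T R C) :
    ∃ (k : ℕ) (C R : Fin k → Set X), (∀ i, C i ∈ 𝒞) ∧ (∀ i, IsRegion T (R i) (C i)) ∧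
      (∀ i, R i ⊆ B (C i)) ∧ (∀ i, (R i ∩ C i).Nonempty) ∧
      (Pairwise fun i j => Disjoint (R i) (R j)) ∧
      (∀ x, ∃ n, T^[n] x ∈ ⋃ i, R i) ∧ ∀ x, ∃ n, T.symm^[n] x ∈ ⋃ i, R i := by
  classical
  -- Pairs of a class and one of its regions, the region meeting the class.
  set Q : Set (Set X × Set X) :=
    {q | q.1 ∈ 𝒞 ∧ (q.2 ∩ q.1).Nonempty ∧ q.2 ⊆ B q.1 ∧ IsRegion T q.2 q.1}
  have key : ∀ A : Set X, (∃ C ∈ 𝒞, (A ∩ C).Nonempty) → ∃ q ∈ Q, (A ∩ q.2).Nonempty := by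
    rintro A ⟨C, hC𝒞, p, hpA, hpC⟩
    obtain ⟨R, hpR, hRB, hreg⟩ := hR C hC𝒞 p hpC
    exact ⟨(C, R), ⟨hC𝒞, ⟨p, hpR, hpC⟩, hRB, hreg⟩, p, hpA, hpR⟩
  have hopen : ∀ q ∈ Q, IsOpen q.2 := fun q hq => hq.2.2.2.isClopen.isOpen
  obtain ⟨t₁, ht₁, hcov₁⟩ := exists_finset_regions_of_omegaSet T Q hopen fun x => key _ (hω x)
  obtain ⟨t₂, ht₂, hcov₂⟩ :=
    exists_finset_regions_of_omegaSet T.symm Q hopen fun x => key _ (hα x)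
  set t := t₁ ∪ t₂
  have ht : ∀ q ∈ t, q ∈ Q := fun q hq => (Finset.mem_union.1 hq).elim (ht₁ q) (ht₂ q)
  set s := t.image Prod.fst
  let e := s.equivFin.symm
  let C : Fin s.card → Set X := fun i => (e i : Set X)
  have hCinj : Injective C := Subtype.val_injective.comp e.injective
  have hC𝒞 : ∀ i, C i ∈ 𝒞 := by
    intro i
    obtain ⟨q, hq, hqi⟩ := Finset.mem_image.1 (e i).2
    change (e i : Set X) ∈ 𝒞
    rw [← hqi]
    exact (ht q hq).1
  have hCdisj : ∀ i j, i ≠ j → Disjoint (C i) (C j) := fun i j hij =>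
    hdisj (hC𝒞 i) (hC𝒞 j) (hCinj.ne hij)
  -- Regions of the same class are merged first, so that the sets to be made disjoint belong to
  -- distinct classes.
  let U : Fin s.card → Set X := fun i => ⋃ q ∈ {q | q ∈ t ∧ q.1 = C i}, q.2
  have hUreg : ∀ i, IsRegion T (U i) (C i) := fun i =>
    IsRegion.biUnion (t.finite_toSet.subset fun q hq => hq.1) fun q hq => by
      rw [← hq.2]; exact (ht q hq.1).2.2.2
  have hdis : ∀ i, disjointed U i = U i \ ⋃ j ∈ Iio i, U j := by
    intro i
    rw [disjointed_apply, Finset.sup_set_eq_biUnion]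
    simp
  have hmem : ∀ q ∈ t, ∀ x ∈ q.2, x ∈ ⋃ i, disjointed U i := by
    intro q hq x hx
    rw [iUnion_disjointed]
    let i := e.symm ⟨q.1, Finset.mem_image_of_mem Prod.fst hq⟩
    refine mem_iUnion.2 ⟨i, mem_biUnion (x := q) ⟨hq, ?_⟩ hx⟩
    change q.1 = (e i : Set X)
    simp [i]
  refine ⟨s.card, C, disjointed U, hC𝒞, fun i => ?_, fun i => ?_, fun i => ?_,
    disjoint_disjointed U, fun x => ?_, fun x => ?_⟩
  · rw [hdis]
    exact (hUreg i).diff_biUnion (toFinite _) (fun j _ => hUreg j)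
      fun j hj => hCdisj i j (ne_of_gt hj)
  · refine (disjointed_subset U i).trans (iUnion₂_subset fun q hq => ?_)
    rw [← hq.2]
    exact (ht q hq.1).2.2.1
  · obtain ⟨q, hq, hqi⟩ := Finset.mem_image.1 (e i).2
    change q.1 = C i at hqi
    obtain ⟨p, hpR, hpC⟩ := (ht q hq).2.1
    rw [hqi] at hpC
    refine ⟨p, ?_, hpC⟩
    rw [hdis]
    refine ⟨mem_biUnion (x := q) ⟨hq, hqi⟩ hpR, fun hp => ?_⟩
    obtain ⟨j, hj, hpj⟩ := mem_iUnion₂.1 hp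
    -- A point of the class `C i` has both limit sets in `C i`, so it cannot lie in a region of `C
    -- j` and survives the removal.
    have hd := hCdisj i j (ne_of_gt hj)
    rcases (hUreg j).stays p hpj with ⟨-, h⟩ | ⟨-, h⟩
    · obtain ⟨w, hw⟩ := omegaSet_nonempty (T := T) (x := p)
      exact hd.le_bot ⟨(hC _ (hC𝒞 i) p hpC).1 hw, h hw⟩
    · obtain ⟨w, hw⟩ := omegaSet_nonempty (T := T.symm) (x := p)
      exact hd.le_bot ⟨(hC _ (hC𝒞 i) p hpC).2 hw, h hw⟩
  · obtain ⟨q, hq, n, hn⟩ := hcov₁ x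
    exact ⟨n, hmem q (Finset.mem_union_left _ hq) _ hn⟩
  · obtain ⟨q, hq, n, hn⟩ := hcov₂ x
    exact ⟨n, hmem q (Finset.mem_union_right _ hq) _ hn⟩

end Homeomorph

/-! ### Increasing maps of ordered spaces near a fixed point. -/

section OrdConnectedImage

variable {X : Type*} [LinearOrder X] {f : X → X} {A K U C : Set X}

theorem StrictMonoOn.ordConnected_inter_preimage (hf : StrictMonoOn f U) (hU : OrdConnected U)
    (hC : OrdConnected C) : OrdConnected (U ∩ f ⁻¹' C) := by
  refine ⟨fun a ha b hb z hz => ?_⟩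
  have hzU : z ∈ U := hU.out ha.1 hb.1 hz
  exact ⟨hzU, hC.out ha.2 hb.2 ⟨(hf.le_iff_le ha.1 hzU).2 hz.1, (hf.le_iff_le hzU hb.1).2 hz.2⟩⟩

theorem StrictMonoOn.ordConnected_image_of_subset (hf : StrictMonoOn f K)
    (hfK : OrdConnected (f '' K)) (hAK : A ⊆ K) (hA : OrdConnected A) : OrdConnected (f '' A) := by
  refine ⟨?_⟩
  rintro _ ⟨a, ha, rfl⟩ _ ⟨b, hb, rfl⟩ z hz
  obtain ⟨k, hk, rfl⟩ := hfK.out (mem_image_of_mem f (hAK ha)) (mem_image_of_mem f (hAK hb)) hz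
  exact ⟨k, hA.out ha hb ⟨(hf.le_iff_le (hAK ha) hk).1 hz.1, (hf.le_iff_le hk (hAK hb)).1 hz.2⟩,
    rfl⟩

variable [TopologicalSpace X] [OrderTopology X]

theorem Monotone.mapClusterPt_unique {a : ℕ → X} (ha : Monotone a) {w w' : X}
    (hw : MapClusterPt w atTop a) (hw' : MapClusterPt w' atTop a) : w = w' := by
  have key : ∀ {w w' : X}, MapClusterPt w atTop a → MapClusterPt w' atTop a → ¬ w < w' := by
    intro w w' hw hw' hlt
    obtain ⟨u, v, hu, hv, hwu, hwv, huv⟩ := order_separated hlt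
    obtain ⟨k, -, hk⟩ := frequently_atTop.1
      (mapClusterPt_iff_frequently.1 hw' v (hv.mem_nhds hwv)) 0
    obtain ⟨l, hl, hl'⟩ := frequently_atTop.1
      (mapClusterPt_iff_frequently.1 hw u (hu.mem_nhds hwu)) k
    exact absurd (ha hl) (huv _ hl' _ hk).not_ge
  exact le_antisymm (not_lt.1 (key hw' hw)) (not_lt.1 (key hw hw'))

theorem Antitone.mapClusterPt_unique {a : ℕ → X} (ha : Antitone a) {w w' : X}
    (hw : MapClusterPt w atTop a) (hw' : MapClusterPt w' atTop a) : w = w' :=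
  Monotone.mapClusterPt_unique (X := Xᵒᵈ) (a := a) ha.dual_right hw hw'

/-- Near a fixed point with an open upper ray, one of two mutually inverse increasing maps sends a
small clopen interval into itself. -/
theorem exists_isClopen_mapsTo_of_isOpen_Ici (hray : ∀ p : X, IsOpen (Ici p) ∨ IsOpen (Iic p))
    {f g : X → X} (hgf : LeftInverse g f) {p : X} (hp : f p = p) (hIci : IsOpen (Ici p))
    (hf : StrictMonoOn f U) (hfU : OrdConnected (f '' U)) (hU : U ∈ 𝓝 p) {W : Set X}
    (hW : W ∈ 𝓝 p) :
    ∃ N, IsClopen N ∧ p ∈ N ∧ N ⊆ U ∩ W ∧ (MapsTo f N N ∨ MapsTo g N N) := by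
  obtain ⟨b, c, hpI, hIn, hIs⟩ := exists_Icc_mem_subset_of_mem_nhds (inter_mem hU hW)
  have hIU : Icc b c ⊆ U := fun z hz => (hIs hz).1
  have hcU : c ∈ U := hIU ⟨hpI.1.trans hpI.2, le_rfl⟩
  have hpU : p ∈ U := hIU hpI
  have hsub : Icc p c ⊆ Icc b c := Icc_subset_Icc_left hpI.1
  have hpull : c < f c → ∀ z, p ≤ z → z ≤ c → ∃ w ∈ U, f w = z ∧ p ≤ w ∧ w < c := by
    intro hc z hpz hzc
    obtain ⟨w, hw, rfl⟩ := hfU.out (mem_image_of_mem f hpU) (mem_image_of_mem f hcU)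
      (show z ∈ Icc (f p) (f c) from ⟨by rwa [hp], hzc.trans hc.le⟩)
    refine ⟨w, hw, rfl, ?_, (hf.lt_iff_lt hw hcU).1 (hzc.trans_lt hc)⟩
    rw [← hf.le_iff_le hpU hw, hp]
    exact hpz
  -- If `p` is the top of its neighbourhood, the open upper ray makes `p` isolated.
  rcases hpI.2.eq_or_lt with rfl | hpc
  · refine ⟨{p}, ⟨isClosed_singleton, ?_⟩, rfl, by simpa using hIs hpI,
      Or.inl (by simpa [MapsTo] using hp)⟩
    have : {p} = Ici p ∩ interior (Icc b p) := by
      ext z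
      constructor
      · rintro rfl
        exact ⟨le_rfl, mem_interior_iff_mem_nhds.2 hIn⟩
      · rintro ⟨h1, h2⟩
        exact le_antisymm (interior_subset h2).2 h1
    rw [this]
    exact hIci.inter isOpen_interior
  -- Whichever ray at `c` is open decides whether `[p, c)` or `[p, c]` is clopen. Comparing `f c`
  -- with `c` then decides whether `f` or its inverse `g` preserves that interval.
  rcases hray c with hc | hc
  · have hIio : IsClosed (Iio c) := by rw [← compl_Ici]; exact hc.isClosed_compl
    refine ⟨Ico p c, ⟨isClosed_Ici.inter hIio, hIci.inter isOpen_Iio⟩, ⟨le_rfl, hpc⟩,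
      Ico_subset_Icc_self.trans (hsub.trans hIs), ?_⟩
    rcases le_or_gt (f c) c with h | h
    · refine Or.inl fun z hz => ?_
      have hzU := hIU (hsub ⟨hz.1, hz.2.le⟩)
      exact ⟨hp.symm.le.trans ((hf.le_iff_le hpU hzU).2 hz.1), (hf hzU hcU hz.2).trans_le h⟩
    · refine Or.inr fun z hz => ?_
      obtain ⟨w, -, rfl, h1, h2⟩ := hpull h z hz.1 hz.2.le
      rw [hgf]
      exact ⟨h1, h2⟩
  · refine ⟨Icc p c, ⟨isClosed_Icc, hIci.inter hc⟩, ⟨le_rfl, hpc.le⟩, hsub.trans hIs, ?_⟩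
    rcases le_or_gt (f c) c with h | h
    · refine Or.inl fun z hz => ?_
      have hzU := hIU (hsub hz)
      exact ⟨hp.symm.le.trans ((hf.le_iff_le hpU hzU).2 hz.1),
        ((hf.le_iff_le hzU hcU).2 hz.2).trans h⟩
    · refine Or.inr fun z hz => ?_
      obtain ⟨w, -, rfl, h1, h2⟩ := hpull h z hz.1 hz.2
      rw [hgf]
      exact ⟨h1, h2.le⟩

theorem exists_isClopen_mapsTo (hray : ∀ p : X, IsOpen (Ici p) ∨ IsOpen (Iic p))
    {f g : X → X} (hgf : LeftInverse g f) {p : X} (hp : f p = p)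
    (hf : StrictMonoOn f U) (hfU : OrdConnected (f '' U)) (hU : U ∈ 𝓝 p) {W : Set X}
    (hW : W ∈ 𝓝 p) :
    ∃ N, IsClopen N ∧ p ∈ N ∧ N ⊆ U ∩ W ∧ (MapsTo f N N ∨ MapsTo g N N) := by
  rcases hray p with h | h
  · exact exists_isClopen_mapsTo_of_isOpen_Ici hray hgf hp h hf hfU hU hW
  · exact exists_isClopen_mapsTo_of_isOpen_Ici (X := Xᵒᵈ) (fun p => (hray p).symm) hgf hp h
      hf.dual hfU.dual hU hW

end OrdConnectedImage

/-! ### Piecewise increasing homeomorphisms and regions of periodic points. -/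

namespace Homeomorph

variable {X : Type*} [TopologicalSpace X] [LinearOrder X]
  {T : X ≃ₜ X} {x y w p : X} {K M : Set X}

/-- An open interval on which `T` is increasing, with image an interval. -/
structure IsPiece (T : X ≃ₜ X) (K : Set X) : Prop where
  isOpen : IsOpen K
  ordConnected : OrdConnected K
  strictMonoOn : StrictMonoOn T K
  ordConnected_image : OrdConnected (T '' K)

theorem IsPiece.symm (h : IsPiece T K) : IsPiece T.symm (T '' K) where
  isOpen := T.isOpen_image.2 h.isOpen
  ordConnected := h.ordConnected_image
  strictMonoOn := by
    rintro _ ⟨a, ha, rfl⟩ _ ⟨b, hb, rfl⟩ hab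
    simpa using (h.strictMonoOn.lt_iff_lt ha hb).1 hab
  ordConnected_image := by
    have : T.symm '' (T '' K) = K := by rw [← image_comp]; simp
    rw [this]
    exact h.ordConnected

/-- Finitely many pieces cover the space. -/
def IsPiecewiseMono (T : X ≃ₜ X) : Prop :=
  ∃ 𝒦 : Set (Set X), 𝒦.Finite ∧ (∀ K ∈ 𝒦, IsPiece T K) ∧ ∀ x, ∃ K ∈ 𝒦, x ∈ K

theorem IsPiecewiseMono.symm (h : IsPiecewiseMono T) : IsPiecewiseMono T.symm := by
  obtain ⟨𝒦, hfin, hK, hcov⟩ := h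
  refine ⟨(fun K => T '' K) '' 𝒦, hfin.image _, ?_, fun x => ?_⟩
  · rintro _ ⟨K, hK', rfl⟩
    exact (hK K hK').symm
  · obtain ⟨K, hK', hx⟩ := hcov (T.symm x)
    exact ⟨T '' K, mem_image_of_mem _ hK', T.symm x, hx, T.apply_symm_apply x⟩

theorem IsPiecewiseMono.exists_strictMonoOn_iterate (h : IsPiecewiseMono T) (n : ℕ) (p : X) :
    ∃ U, IsOpen U ∧ p ∈ U ∧ OrdConnected U ∧ StrictMonoOn T^[n] U ∧
      OrdConnected (T^[n] '' U) := by
  induction n with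
  | zero => exact ⟨univ, isOpen_univ, mem_univ _, ordConnected_univ, strictMonoOn_id, by
      simpa using ordConnected_univ⟩
  | succ n ih =>
    obtain ⟨U, hUo, hpU, hUc, hUm, hUi⟩ := ih
    obtain ⟨𝒦, -, hK, hcov⟩ := h
    obtain ⟨K, hK', hpK⟩ := hcov (T^[n] p)
    have hK := hK K hK'
    refine ⟨U ∩ T^[n] ⁻¹' K, hUo.inter (hK.isOpen.preimage (T.continuous.iterate n)),
      ⟨hpU, hpK⟩, hUm.ordConnected_inter_preimage hUc hK.ordConnected, ?_, ?_⟩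
    · intro a ha b hb hab
      rw [iterate_succ_apply', iterate_succ_apply']
      exact hK.strictMonoOn ha.2 hb.2 (hUm ha.1 hb.1 hab)
    · rw [iterate_succ', image_comp, image_inter_preimage]
      exact hK.strictMonoOn.ordConnected_image_of_subset hK.ordConnected_image inter_subset_right
        (hUi.inter hK.ordConnected)

/-! ### Periodic orbits -/

variable [OrderTopology X]

theorem IsPiecewiseMono.exists_isClopen_mapsTo (hT : IsPiecewiseMono T)
    (hray : ∀ p : X, IsOpen (Ici p) ∨ IsOpen (Iic p)) {q : ℕ} (hp : IsPeriodicPt T q p)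
    {W : Set X} (hW : W ∈ 𝓝 p) :
    ∃ N, IsClopen N ∧ p ∈ N ∧ N ⊆ W ∧
      ((MapsTo T^[q] N N ∧ StrictMonoOn T^[q] N) ∨
        (MapsTo T.symm^[q] N N ∧ StrictMonoOn T.symm^[q] N)) := by
  obtain ⟨U, hUo, hpU, -, hm, hi⟩ := hT.exists_strictMonoOn_iterate q p
  obtain ⟨N, hN, hpN, hNU, h⟩ := _root_.exists_isClopen_mapsTo hray
    (g := T.symm^[q]) (symm_iterate_iterate T q) hp hm hi (hUo.mem_nhds hpU) hW
  have hmN : StrictMonoOn T^[q] N := hm.mono fun z hz => (hNU hz).1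
  refine ⟨N, hN, hpN, fun z hz => (hNU hz).2, h.imp (fun h => ⟨h, hmN⟩) fun h => ⟨h, ?_⟩⟩
  intro a ha b hb hab
  rw [← hmN.lt_iff_lt (h ha) (h hb), iterate_symm_iterate, iterate_symm_iterate]
  exact hab

/-- A point which is both a future and a past limit point of `y` and is periodic lies on the
orbit of `y`. -/
theorem IsPiecewiseMono.exists_iterate_eq (hT : IsPiecewiseMono T)
    (hray : ∀ p : X, IsOpen (Ici p) ∨ IsOpen (Iic p)) {q : ℕ} (hq : 0 < q)
    (hp : IsPeriodicPt T q p) (hω : p ∈ T.omegaSet y) (hα : p ∈ T.symm.omegaSet y) :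
    ∃ r, T^[r] y = p := by
  by_contra! hne
  -- The neighbourhood `N` of `p` will avoid the points of the orbit of `y` at times `0, ..., q`. A
  -- visit to `N` is moved by multiples of `q` into this window, which gives the contradiction.
  have hfin : ((fun r => T^[r] y) '' Iic q).Finite := (finite_Iic q).image _
  obtain ⟨N, hN, hpN, hNW, h⟩ := hT.exists_isClopen_mapsTo hray hp
    (hfin.isClosed.isOpen_compl.mem_nhds (by rintro ⟨r, -, hr⟩; exact hne r hr))
  have hNn := hN.isOpen.mem_nhds hpN
  rcases h with ⟨h, -⟩ | ⟨h, -⟩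
  · obtain ⟨n, -, hn⟩ := mem_omegaSet_iff.1 hα N hNn 0
    have hmod := Nat.div_add_mod n q
    have hlt := Nat.mod_lt n hq
    have h1 := iterate_mul_mem h hn (n / q + 1)
    -- The visit at time `-n` is carried to time `q - n % q`, which lies between `1` and `q`.
    rw [mul_add, mul_one, iterate_symm_iterate_of_le T (by omega)] at h1
    exact hNW h1 ⟨_, by simp only [mem_Iic]; omega, rfl⟩
  · obtain ⟨n, -, hn⟩ := mem_omegaSet_iff.1 hω N hNn 0
    have hmod := Nat.div_add_mod n q
    have hlt := Nat.mod_lt n hq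
    have h1 := iterate_mul_mem h hn (n / q)
    rw [show T^[n] y = T.symm.symm^[n] y from rfl,
      iterate_symm_iterate_of_ge T.symm (by omega)] at h1
    exact hNW h1 ⟨_, by simp only [mem_Iic]; omega, rfl⟩

/-- Since `N` returns to itself only at multiples of `q`, visits to `N` are governed by the
increasing map `T^q`. Its orbits in `N` are monotone sequences, so their cluster points in `N` are
fixed by `T^q`, and the return times force the minimal period to be exactly `q`. -/
theorem isRegion_iUnion_image {q : ℕ} (hq : 0 < q) {N : Set X} (hN : IsClopen N)
    (hmap : MapsTo T^[q] N N) (hmono : StrictMonoOn T^[q] N)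
    (hdis : ∀ z ∈ N, ∀ i, 0 < i → i < q → T^[i] z ∉ N) :
    IsRegion T (⋃ i ∈ Iio q, T^[i] '' N) {x | minimalPeriod T x = q} := by
  have hmem : ∀ z ∈ N, ∀ n, T^[n] z ∈ ⋃ i ∈ Iio q, T^[i] '' N := by
    intro z hz n
    refine mem_biUnion (x := n % q) (Nat.mod_lt n hq) ⟨_, iterate_mul_mem hmap hz (n / q), ?_⟩
    rw [← iterate_add_apply, Nat.mod_add_div]
  have hclopen : IsClopen (⋃ i ∈ Iio q, T^[i] '' N) := by
    refine (finite_Iio q).isClopen_biUnion fun i _ => ?_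
    rw [image_eq_preimage_of_inverse (symm_iterate_iterate T i) (iterate_symm_iterate T i)]
    exact hN.preimage (T.symm.continuous.iterate i)
  have hdvd : ∀ z ∈ N, ∀ n, T^[n] z ∈ N → q ∣ n := by
    intro z hz n hn
    by_contra hnd
    have := Nat.mod_add_div n q
    refine hdis _ (iterate_mul_mem hmap hz (n / q)) (n % q)
      (Nat.pos_of_ne_zero fun h => hnd (Nat.dvd_of_mod_eq_zero h)) (Nat.mod_lt n hq) ?_
    rwa [← iterate_add_apply, this]
  have hfix : ∀ z ∈ N, ∀ w ∈ N, w ∈ T.omegaSet z → minimalPeriod T w = q := by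
    intro z hz w hw hwz
    have hcl : ∀ w ∈ N, w ∈ T.omegaSet z → MapClusterPt w atTop fun k => T^[q * k] z := by
      intro w hw hwz
      rw [mapClusterPt_iff_frequently]
      intro U hU
      rw [frequently_atTop]
      intro k
      obtain ⟨n, hn, hnU⟩ := mem_omegaSet_iff.1 hwz _ (inter_mem hU (hN.isOpen.mem_nhds hw))
        (q * k)
      obtain ⟨l, rfl⟩ := hdvd z hz n hnU.2
      exact ⟨l, Nat.le_of_mul_le_mul_left hn hq, hnU.1⟩
    have hsucc : ∀ k, T^[q * (k + 1)] z = T^[q] (T^[q * k] z) := fun k => by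
      rw [← iterate_add_apply, mul_add, mul_one, add_comm]
    have hper : T^[q] w = w := by
      -- Both `w` and `T^q w` are cluster points of the same monotone sequence, hence equal.
      have h1 := hcl w hw hwz
      have h2 := hcl _ (hmap hw) (iterate_mem_omegaSet hwz q)
      rcases le_total z (T^[q] z) with h | h
      · refine Monotone.mapClusterPt_unique (monotone_nat_of_le_succ fun k => ?_) h2 h1
        induction k with
        | zero => simpa using h
        | succ k ih =>
          rw [hsucc k, hsucc (k + 1)]
          exact (hmono.le_iff_le (iterate_mul_mem hmap hz _) (iterate_mul_mem hmap hz _)).2 ih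
      · refine Antitone.mapClusterPt_unique (antitone_nat_of_succ_le fun k => ?_) h2 h1
        induction k with
        | zero => simpa using h
        | succ k ih =>
          rw [hsucc k, hsucc (k + 1)]
          exact (hmono.le_iff_le (iterate_mul_mem hmap hz _) (iterate_mul_mem hmap hz _)).2 ih
    have hper' : IsPeriodicPt T q w := hper
    refine Nat.dvd_antisymm hper'.minimalPeriod_dvd (hdvd w hw _ ?_)
    rwa [iterate_minimalPeriod]
  refine ⟨hclopen, fun x hx => Or.inl ?_⟩
  obtain ⟨i, -, z, hz, rfl⟩ := mem_iUnion₂.1 hx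
  have hst : ∀ n, T^[n] (T^[i] z) ∈ ⋃ i ∈ Iio q, T^[i] '' N := fun n => by
    rw [← iterate_add_apply]
    exact hmem z hz _
  refine ⟨hst, fun w hw => ?_⟩
  obtain ⟨j, -, v, hv, rfl⟩ := mem_iUnion₂.1 (omegaSet_subset_of_forall_mem hclopen.isClosed hst hw)
  rw [omegaSet_iterate] at hw
  have hv' := symm_iterate_mem_omegaSet hw j
  rw [symm_iterate_iterate] at hv'
  have h := hfix z hz v hv hv'
  change minimalPeriod T (T^[j] v) = q
  rw [minimalPeriod_apply_iterate (minimalPeriod_pos_iff_mem_periodicPts.1 (h ▸ hq)), h]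

/-- The interval is taken so small that its points do not return at times `1, ..., q - 1`. If only
the inverse of `T^q` preserves it, the construction is applied to `T.symm`, which has the same
regions. -/
theorem IsPiecewiseMono.exists_isRegion_of_periodic (hT : IsPiecewiseMono T)
    (hray : ∀ p : X, IsOpen (Ici p) ∨ IsOpen (Iic p)) {q : ℕ} (hq : 0 < q)
    (hp : minimalPeriod T p = q) :
    ∃ R, p ∈ R ∧ IsRegion T R {x | minimalPeriod T x = q} := by
  have hsep : ∀ i ∈ Ioo 0 q, ∃ W ∈ 𝓝 p, ∀ z ∈ W, T^[i] z ∉ W := by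
    intro i hi
    have hne : p ≠ T^[i] p := fun h =>
      not_isPeriodicPt_of_pos_of_lt_minimalPeriod hi.1.ne' (hp ▸ hi.2) h.symm
    obtain ⟨A, B, hA, hB, hpA, hpB, hAB⟩ := t2_separation hne
    refine ⟨A ∩ T^[i] ⁻¹' B, inter_mem (hA.mem_nhds hpA)
      ((T.continuous.iterate i).continuousAt (hB.mem_nhds hpB)), fun z hz hz' => ?_⟩
    exact hAB.le_bot ⟨hz'.1, hz.2⟩
  choose! W hW hWsep using hsep
  obtain ⟨N, hN, hpN, hNW, h⟩ := hT.exists_isClopen_mapsTo hray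
    (hp ▸ isPeriodicPt_minimalPeriod T p) ((biInter_mem (finite_Ioo 0 q)).2 hW)
  have hdis : ∀ z ∈ N, ∀ i, 0 < i → i < q → T^[i] z ∉ N := fun z hz i h0 hi hz' =>
    hWsep i ⟨h0, hi⟩ z (mem_iInter₂.1 (hNW hz) i ⟨h0, hi⟩) (mem_iInter₂.1 (hNW hz') i ⟨h0, hi⟩)
  rcases h with ⟨h1, h2⟩ | ⟨h1, h2⟩
  · refine ⟨_, ?_, isRegion_iUnion_image hq hN h1 h2 hdis⟩
    exact mem_biUnion (x := 0) hq ⟨p, hpN, rfl⟩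
  · have hreg := isRegion_iUnion_image hq hN h1 h2 fun z hz i h0 hi hz' =>
      hdis _ hz' i h0 hi (by rwa [iterate_symm_iterate])
    simp only [minimalPeriod_symm] at hreg
    refine ⟨_, ?_, hreg.symm⟩
    exact mem_biUnion (x := 0) hq ⟨p, hpN, rfl⟩

end Homeomorph

/-! ### Gaps and regions of aperiodic minimal sets. -/

namespace Homeomorph

variable {X : Type*} [LinearOrder X] {M : Set X} {x : X} {g g' : X × X}

/-- The pairs of neighbouring points of `M`. -/
def gaps (M : Set X) : Set (X × X) :=
  {g | g.1 ∈ M ∧ g.2 ∈ M ∧ g.1 < g.2 ∧ ∀ z ∈ Ioo g.1 g.2, z ∉ M}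

theorem eq_of_mem_gaps (hg : g ∈ gaps M) (hg' : g' ∈ gaps M) (hx : x ∈ Ioo g.1 g.2)
    (hx' : x ∈ Ioo g'.1 g'.2) : g = g' := by
  have key : ∀ {g g' : X × X}, g ∈ gaps M → g' ∈ gaps M → x ∈ Ioo g.1 g.2 →
      x ∈ Ioo g'.1 g'.2 → g.1 ≤ g'.1 ∧ g.2 ≤ g'.2 := fun {g g'} hg hg' hx hx' =>
    ⟨not_lt.1 fun h => hg'.2.2.2 g.1 ⟨h, hx.1.trans hx'.2⟩ hg.1,
      not_lt.1 fun h => hg.2.2.2 g'.2 ⟨hx.1.trans hx'.2, h⟩ hg'.2.1⟩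
  have h1 := key hg hg' hx hx'
  have h2 := key hg' hg hx' hx
  exact Prod.ext (le_antisymm h1.1 h2.1) (le_antisymm h1.2 h2.2)

variable [TopologicalSpace X]

variable {T : X ≃ₜ X} {K : Set X} {F₀ : Set (X × X)}

/-- The gaps whose orbits meet `F₀` both in the future and in the past. -/
def trappedGaps (T : X ≃ₜ X) (M : Set X) (F₀ : Set (X × X)) : Set (X × X) :=
  {g ∈ gaps M | (∃ n, Prod.map T^[n] T^[n] g ∈ F₀) ∧
    ∃ n, Prod.map T.symm^[n] T.symm^[n] g ∈ F₀}

theorem trappedGaps_symm : trappedGaps T.symm M F₀ = trappedGaps T M F₀ := by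
  ext g
  exact and_congr_right fun _ => and_comm

/-- The endpoints of a gap in `F₀` are aperiodic, so its iterates return to the finite set `F₀` only
finitely often. A trapped gap is an iterate of a gap in `F₀` at a time not exceeding the last
return. -/
theorem finite_trappedGaps (hap : ∀ x ∈ M, x ∉ periodicPts T) (hF₀ : F₀.Finite)
    (hsub : F₀ ⊆ gaps M) : (trappedGaps T M F₀).Finite := by
  have hfin : ∀ g ∈ F₀, {n : ℕ | Prod.map T^[n] T^[n] g ∈ F₀}.Finite := by
    intro g hg
    refine hF₀.preimage (f := fun n => Prod.map T^[n] T^[n] g) (Injective.injOn fun m n hmn => ?_)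
    exact iterate_injective_of_notMem_periodicPts (hap _ (hsub hg).1) (congrArg Prod.fst hmn)
  have hbdd : ∀ g ∈ F₀, ∃ N, ∀ n, Prod.map T^[n] T^[n] g ∈ F₀ → n ≤ N := fun g hg =>
    (hfin g hg).bddAbove
  choose! N hN using hbdd
  refine (hF₀.biUnion fun g _ => (finite_Iic (N g)).image
    fun n => Prod.map T^[n] T^[n] g).subset ?_
  rintro g ⟨-, ⟨n, hn⟩, m, hm⟩
  have hback : Prod.map T^[m] T^[m] (Prod.map T.symm^[m] T.symm^[m] g) = g := by
    ext <;> simp [iterate_symm_iterate]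
  refine mem_biUnion hm ⟨m, ?_, hback⟩
  refine le_trans (Nat.le_add_left m n) (hN _ hm (n + m) ?_)
  rw [← hback] at hn
  simpa [Prod.map, iterate_add_apply] using hn

/-- `T` maps the gap `g` to a gap, compatibly with the points inside. -/
def MapsGap (T : X ≃ₜ X) (M : Set X) (g : X × X) : Prop :=
  Prod.map T T g ∈ gaps M ∧ ∀ x ∈ Ioo g.1 g.2, T x ∈ Ioo (T g.1) (T g.2) ∧
    (g.1 ⋖ x → T g.1 ⋖ T x)

theorem IsPiece.mapsGap (hK : IsPiece T K) (hM : MapsTo T M M) (hM' : MapsTo T.symm M M)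
    (hg : g ∈ gaps M) (h1 : g.1 ∈ K) (h2 : g.2 ∈ K) : MapsGap T M g := by
  have hin : ∀ x ∈ Ioo g.1 g.2, x ∈ K := fun x hx => hK.ordConnected.out h1 h2 ⟨hx.1.le, hx.2.le⟩
  have hpull : ∀ z ∈ Ioo (T g.1) (T g.2), ∃ x ∈ Ioo g.1 g.2, T x = z := by
    intro z hz
    obtain ⟨x, hx, rfl⟩ := hK.ordConnected_image.out (mem_image_of_mem T h1)
      (mem_image_of_mem T h2) ⟨hz.1.le, hz.2.le⟩
    exact ⟨x, ⟨(hK.strictMonoOn.lt_iff_lt h1 hx).1 hz.1, (hK.strictMonoOn.lt_iff_lt hx h2).1 hz.2⟩,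
      rfl⟩
  refine ⟨⟨hM hg.1, hM hg.2.1, hK.strictMonoOn h1 h2 hg.2.2.1, fun z hz hzM => ?_⟩,
    fun x hx => ⟨⟨hK.strictMonoOn h1 (hin x hx) hx.1, hK.strictMonoOn (hin x hx) h2 hx.2⟩,
      fun hc => ⟨hK.strictMonoOn h1 (hin x hx) hx.1, fun z hz1 hz2 => ?_⟩⟩⟩
  · obtain ⟨x, hx, rfl⟩ := hpull z hz
    refine hg.2.2.2 x hx ?_
    have := hM' hzM
    rwa [T.symm_apply_apply] at this
  · obtain ⟨y, hy, rfl⟩ := hpull z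
      ⟨hz1, hz2.trans (hK.strictMonoOn (hin x hx) h2 hx.2)⟩
    exact hc.2 hy.1 ((hK.strictMonoOn.lt_iff_lt (hin y hy) (hin x hx)).1 hz2)

/-- A gap with both endpoints in one piece is mapped to a gap. For each piece, at most one gap
starts inside it and ends outside. -/
theorem IsPiecewiseMono.finite_not_mapsGap (hT : IsPiecewiseMono T) (hM : MapsTo T M M)
    (hM' : MapsTo T.symm M M) : {g ∈ gaps M | ¬ MapsGap T M g}.Finite := by
  obtain ⟨𝒦, hfin, hK, hcov⟩ := hT
  refine (hfin.biUnion (t := fun K => {g ∈ gaps M | g.1 ∈ K ∧ g.2 ∉ K}) fun K hK' => ?_).subset ?_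
  · refine Subsingleton.finite ?_
    have key : ∀ {g g' : X × X}, g ∈ gaps M → g' ∈ gaps M → g.1 ∈ K → g'.1 ∈ K → g.2 ∉ K →
        ¬ g.1 < g'.1 := by
      intro g g' hg hg' h1 h1' h2 hlt
      refine h2 ((hK K hK').ordConnected.out h1 h1' ⟨hg.2.2.1.le, not_lt.1 fun h => ?_⟩)
      exact hg.2.2.2 _ ⟨hlt, h⟩ hg'.1
    rintro g ⟨hg, h1, h2⟩ g' ⟨hg', h1', h2'⟩
    have he : g.1 = g'.1 := le_antisymm (not_lt.1 (key hg' hg h1' h1 h2'))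
      (not_lt.1 (key hg hg' h1 h1' h2))
    refine Prod.ext he (le_antisymm ?_ ?_)
    · exact not_lt.1 fun h => hg.2.2.2 _ ⟨he ▸ hg'.2.2.1, h⟩ hg'.2.1
    · exact not_lt.1 fun h => hg'.2.2.2 _ ⟨he ▸ hg.2.2.1, h⟩ hg.2.1
  · rintro g ⟨hg, hbad⟩
    obtain ⟨K, hK', h1⟩ := hcov g.1
    exact mem_biUnion hK' ⟨hg, h1, fun h2 => hbad ((hK K hK').mapsGap hM hM' hg h1 h2)⟩

theorem iterate_mem_gaps (hF₀ : ∀ g ∈ gaps M, g ∉ F₀ → MapsGap T M g) (hg : g ∈ gaps M)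
    (hx : x ∈ Ioo g.1 g.2) {n : ℕ} (hn : ∀ k < n, Prod.map T^[k] T^[k] g ∉ F₀) :
    Prod.map T^[n] T^[n] g ∈ gaps M ∧ T^[n] x ∈ Ioo (T^[n] g.1) (T^[n] g.2) ∧
      (g.1 ⋖ x → T^[n] g.1 ⋖ T^[n] x) := by
  induction n with
  | zero => exact ⟨hg, hx, id⟩
  | succ n ih =>
    obtain ⟨h1, h2, h3⟩ := ih fun k hk => hn k (hk.trans n.lt_succ_self)
    obtain ⟨h4, h5⟩ := hF₀ _ h1 (hn n n.lt_succ_self)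
    simp only [iterate_succ', Prod.map, comp_apply] at h4 ⊢
    exact ⟨h4, (h5 _ h2).1, fun h => (h5 _ h2).2 (h3 h)⟩

/-- The convex hull of `M`, without the trapped gaps. -/
def gapRegion (T : X ≃ₜ X) (M : Set X) (F₀ : Set (X × X)) : Set X :=
  {x | (∃ a ∈ M, a ≤ x) ∧ (∃ b ∈ M, x ≤ b) ∧ ∀ g ∈ trappedGaps T M F₀, x ∉ Ioo g.1 g.2}

theorem gapRegion_symm : gapRegion T.symm M F₀ = gapRegion T M F₀ := by
  simp only [gapRegion, trappedGaps_symm]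

theorem subset_gapRegion : M ⊆ gapRegion T M F₀ := fun x hx =>
  ⟨⟨x, hx, le_rfl⟩, ⟨x, hx, le_rfl⟩, fun _ hg hxg => hg.1.2.2.2 x hxg hx⟩

/-- A point in a gap whose future avoids `F₀` stays in the region. -/
theorem iterate_mem_gapRegion (hF₀ : ∀ g ∈ gaps M, g ∉ F₀ → MapsGap T M g) (hg : g ∈ gaps M)
    (hx : x ∈ Ioo g.1 g.2) (hn : ∀ k, Prod.map T^[k] T^[k] g ∉ F₀) (n : ℕ) :
    T^[n] x ∈ gapRegion T M F₀ := by
  obtain ⟨h1, h2, -⟩ := iterate_mem_gaps hF₀ hg hx (n := n) fun k _ => hn k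
  refine ⟨⟨_, h1.1, h2.1.le⟩, ⟨_, h1.2.1, h2.2.le⟩, fun _ hg' hx' => ?_⟩
  obtain rfl := eq_of_mem_gaps h1 hg'.1 h2 hx'
  obtain ⟨k, hk⟩ := hg'.2.1
  refine hn (k + n) ?_
  simpa [Prod.map, iterate_add_apply] using hk

variable [CompactSpace X]

/-- If `u` is locally the greatest point of `M`, an open upper ray at `u` would isolate it in `M`.
Hence gaps, and the convex hull of `M`, have clopen boundaries. -/
theorem IsMinimalSet.isOpen_Iic_of_gap (hM : IsMinimalSet T M)
    (hap : ∀ x ∈ M, x ∉ periodicPts T) (hray : ∀ p : X, IsOpen (Ici p) ∨ IsOpen (Iic p))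
    {u : X} {U : Set X} (hu : u ∈ M) (hU : U ∈ 𝓝 u) (h : ∀ z ∈ U ∩ M, z ≤ u) :
    IsOpen (Iic u) := by
  refine (hray u).resolve_left fun hI => ?_
  obtain ⟨y, hy, hne⟩ := hM.exists_ne_mem hap hu (inter_mem (hI.mem_nhds le_rfl) hU)
  exact hne (le_antisymm (h y ⟨hy.1.2, hy.2⟩) hy.1.1)

theorem IsMinimalSet.isOpen_Ici_of_gap (hM : IsMinimalSet T M)
    (hap : ∀ x ∈ M, x ∉ periodicPts T) (hray : ∀ p : X, IsOpen (Ici p) ∨ IsOpen (Iic p))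
    {u : X} {U : Set X} (hu : u ∈ M) (hU : U ∈ 𝓝 u) (h : ∀ z ∈ U ∩ M, u ≤ z) :
    IsOpen (Ici u) := by
  refine (hray u).resolve_right fun hI => ?_
  obtain ⟨y, hy, hne⟩ := hM.exists_ne_mem hap hu (inter_mem (hI.mem_nhds le_rfl) hU)
  exact hne (le_antisymm hy.1.1 (h y ⟨hy.1.2, hy.2⟩))

variable [OrderTopology X]

theorem exists_gap (hM : IsClosed M) (hx : x ∉ M) (ha : ∃ a ∈ M, a ≤ x) (hb : ∃ b ∈ M, x ≤ b) :
    ∃ g ∈ gaps M, x ∈ Ioo g.1 g.2 := by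
  obtain ⟨u, hu⟩ := (hM.inter isClosed_Iic).isCompact.exists_isGreatest (s := M ∩ Iic x) ha
  obtain ⟨v, hv⟩ := (hM.inter isClosed_Ici).isCompact.exists_isLeast (s := M ∩ Ici x) hb
  have hux : u < x := lt_of_le_of_ne hu.1.2 fun h => hx (h ▸ hu.1.1)
  have hxv : x < v := lt_of_le_of_ne hv.1.2 fun h => hx (h ▸ hv.1.1)
  refine ⟨(u, v), ⟨hu.1.1, hv.1.1, hux.trans hxv, fun z hz hzM => ?_⟩, hux, hxv⟩
  rcases le_total z x with h | h
  · exact (hu.2 ⟨hzM, h⟩).not_gt hz.1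
  · exact (hv.2 ⟨hzM, h⟩).not_gt hz.2

/-- A limit point outside `M` would lie in a gap visited at two different times. The iterated gap
would then equal that gap twice, contradicting the aperiodicity of its endpoints. -/
theorem omegaSet_subset_of_gap (hM : IsClosed M) (hap : ∀ x ∈ M, x ∉ periodicPts T)
    (hcl : IsClosed (gapRegion T M F₀)) (hF₀ : ∀ g ∈ gaps M, g ∉ F₀ → MapsGap T M g)
    (hg : g ∈ gaps M) (hx : x ∈ Ioo g.1 g.2) (hn : ∀ k, Prod.map T^[k] T^[k] g ∉ F₀) :
    T.omegaSet x ⊆ M := by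
  intro w hw
  by_contra hwM
  have hwR := omegaSet_subset_of_forall_mem hcl (iterate_mem_gapRegion hF₀ hg hx hn) hw
  obtain ⟨g', hg', hwg'⟩ := exists_gap hM hwM hwR.1 hwR.2.1
  have hnhds := isOpen_Ioo.mem_nhds hwg'
  obtain ⟨m, -, hm⟩ := mem_omegaSet_iff.1 hw _ hnhds 0
  obtain ⟨l, hl, hlm⟩ := mem_omegaSet_iff.1 hw _ hnhds (m + 1)
  have key : ∀ n, T^[n] x ∈ Ioo g'.1 g'.2 → Prod.map T^[n] T^[n] g = g' := fun n hn' => by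
    obtain ⟨h1, h2, -⟩ := iterate_mem_gaps hF₀ hg hx (n := n) fun k _ => hn k
    exact eq_of_mem_gaps h1 hg' h2 hn'
  have he := congrArg Prod.fst ((key m hm).trans (key l hlm).symm)
  have := iterate_injective_of_notMem_periodicPts (hap _ hg.1) he
  omega

theorem IsMinimalSet.isClopen_gap (hM : IsMinimalSet T M)
    (hap : ∀ x ∈ M, x ∉ periodicPts T) (hray : ∀ p : X, IsOpen (Ici p) ∨ IsOpen (Iic p))
    (hg : g ∈ gaps M) : IsClopen (Ioo g.1 g.2) := by
  have h1 : IsOpen (Iic g.1) := hM.isOpen_Iic_of_gap hap hray hg.1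
    (isOpen_Iio.mem_nhds hg.2.2.1) fun z hz => not_lt.1 fun h => hg.2.2.2 z ⟨h, hz.1⟩ hz.2
  have h2 : IsOpen (Ici g.2) := hM.isOpen_Ici_of_gap hap hray hg.2.1
    (isOpen_Ioi.mem_nhds hg.2.2.1) fun z hz => not_lt.1 fun h => hg.2.2.2 z ⟨hz.1, h⟩ hz.2
  refine ⟨?_, isOpen_Ioo⟩
  rw [← Ioi_inter_Iio, ← compl_Iic, ← compl_Ici]
  exact h1.isClosed_compl.inter h2.isClosed_compl

theorem IsMinimalSet.isClopen_gapRegion (hM : IsMinimalSet T M)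
    (hap : ∀ x ∈ M, x ∉ periodicPts T) (hray : ∀ p : X, IsOpen (Ici p) ∨ IsOpen (Iic p))
    (hF₀ : F₀.Finite) (hsub : F₀ ⊆ gaps M) : IsClopen (gapRegion T M F₀) := by
  obtain ⟨a, ha⟩ := hM.isClosed.isCompact.exists_isLeast hM.nonempty
  obtain ⟨b, hb⟩ := hM.isClosed.isCompact.exists_isGreatest hM.nonempty
  have hIci := hM.isOpen_Ici_of_gap hap hray ha.1 univ_mem fun z hz => ha.2 hz.2
  have hIic := hM.isOpen_Iic_of_gap hap hray hb.1 univ_mem fun z hz => hb.2 hz.2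
  have : gapRegion T M F₀ = (Ici a ∩ Iic b) \ ⋃ g ∈ trappedGaps T M F₀, Ioo g.1 g.2 := by
    ext x
    simp only [gapRegion, mem_ofPred_eq, Set.mem_sdiff, mem_inter_iff, mem_Ici, mem_Iic, mem_iUnion,
      not_exists, and_assoc]
    refine and_congr ⟨fun ⟨c, hc, hcx⟩ => (ha.2 hc).trans hcx, fun h => ⟨a, ha.1, h⟩⟩
      (and_congr ⟨fun ⟨c, hc, hcx⟩ => hcx.trans (hb.2 hc), fun h => ⟨b, hb.1, h⟩⟩ Iff.rfl)
  rw [this]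
  exact (IsClopen.inter ⟨isClosed_Ici, hIci⟩ ⟨isClosed_Iic, hIic⟩).diff
    ((finite_trappedGaps hap hF₀ hsub).isClopen_biUnion fun g hg =>
      hM.isClopen_gap hap hray hg.1)

/-- If the future of `x ∉ M` stays in the region then the left neighbour of `x` in `M` follows it. -/
theorem covBy_iterate_of_forall_mem_gapRegion (hM : IsClosed M)
    (hF₀ : ∀ g ∈ gaps M, g ∉ F₀ → MapsGap T M g)
    (hx : ∀ n, T^[n] x ∈ gapRegion T M F₀)
    (hxM : x ∉ M) {u : X} (hu : u ∈ M) (hux : u ⋖ x) (n : ℕ) : T^[n] u ⋖ T^[n] x := by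
  obtain ⟨g, hg, hxg⟩ := exists_gap hM hxM (hx 0).1 (hx 0).2.1
  have hgu : g.1 = u := by
    rcases lt_trichotomy g.1 u with h | h | h
    · exact absurd hu (hg.2.2.2 u ⟨h, hux.1.trans hxg.2⟩)
    · exact h
    · exact absurd hxg.1 (hux.2 h)
  subst hgu
  by_cases hfut : ∀ k, Prod.map T^[k] T^[k] g ∉ F₀
  · exact (iterate_mem_gaps hF₀ hg hxg (n := n) fun k _ => hfut k).2.2 hux
  -- At its first entry into `F₀` the iterated gap is itself trapped, with both meeting times equal
  -- to `0`. This contradicts that the orbit of `x` stays in the region.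
  push Not at hfut
  classical
  obtain ⟨h1, h2, -⟩ := iterate_mem_gaps hF₀ hg hxg (n := Nat.find hfut)
    fun j hj => Nat.find_min hfut hj
  exact absurd h2 ((hx _).2.2 _ ⟨h1, ⟨0, Nat.find_spec hfut⟩, 0, Nat.find_spec hfut⟩)

/-- In a region of `M`, the left neighbours in `M` of points outside `M` are followed by them. -/
def FollowsLeft (T : X ≃ₜ X) (R M : Set X) : Prop :=
  ∀ x u, (∀ n, T^[n] x ∈ R) → (∀ n, T.symm^[n] x ∈ R) →
    x ∉ M → u ∈ M → u ⋖ x → ∀ n, T^[n] u ⋖ T^[n] x ∧ T.symm^[n] u ⋖ T.symm^[n] x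

/-- An aperiodic minimal set has a region in which the left neighbours of points outside `M` are
followed by the points. -/
theorem IsMinimalSet.exists_isRegion (hT : IsPiecewiseMono T) (hM : IsMinimalSet T M)
    (hap : ∀ x ∈ M, x ∉ periodicPts T) (hray : ∀ p : X, IsOpen (Ici p) ∨ IsOpen (Iic p)) :
    ∃ R, M ⊆ R ∧ IsRegion T R M ∧ FollowsLeft T R M := by
  -- The finitely many gaps not carried to gaps by `T` or by its inverse.
  set F₀ : Set (X × X) := {g ∈ gaps M | ¬ MapsGap T M g} ∪ {g ∈ gaps M | ¬ MapsGap T.symm M g}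
  have hfin : F₀.Finite := (hT.finite_not_mapsGap hM.mapsTo hM.symm_mapsTo).union
    (hT.symm.finite_not_mapsGap hM.symm_mapsTo hM.mapsTo)
  have hsub : F₀ ⊆ gaps M := union_subset (fun g hg => hg.1) fun g hg => hg.1
  have h1 : ∀ g ∈ gaps M, g ∉ F₀ → MapsGap T M g := fun g hg hgF => by
    by_contra h
    exact hgF (Or.inl ⟨hg, h⟩)
  have h2 : ∀ g ∈ gaps M, g ∉ F₀ → MapsGap T.symm M g := fun g hg hgF => by
    by_contra h
    exact hgF (Or.inr ⟨hg, h⟩)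
  have hclopen := hM.isClopen_gapRegion hap hray hfin hsub
  have hap' := IsMinimalSet.aperiodic_symm hap
  refine ⟨gapRegion T M F₀, subset_gapRegion, ⟨hclopen, fun x hx => ?_⟩,
    fun x u hx hx' hxM hu hux n => ?_⟩
  · by_cases hxM : x ∈ M
    · exact Or.inl ⟨fun n => subset_gapRegion (hM.mapsTo.iterate n hxM), (hM.omegaSet_eq hxM).le⟩
    obtain ⟨g, hg, hxg⟩ := exists_gap hM.isClosed hxM hx.1 hx.2.1
    -- The gap around `x` is not trapped, so it avoids `F₀` in the future or in the past, and `x`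
    -- stays in the region in that direction.
    by_cases hfut : ∀ k, Prod.map T^[k] T^[k] g ∉ F₀
    · exact Or.inl ⟨iterate_mem_gapRegion h1 hg hxg hfut,
        omegaSet_subset_of_gap hM.isClosed hap hclopen.isClosed h1 hg hxg hfut⟩
    have hpast : ∀ k, Prod.map T.symm^[k] T.symm^[k] g ∉ F₀ := by
      push Not at hfut
      exact fun k hk => hx.2.2 g ⟨hg, hfut, k, hk⟩ hxg
    rw [← gapRegion_symm] at hclopen ⊢
    exact Or.inr ⟨iterate_mem_gapRegion h2 hg hxg hpast,
      omegaSet_subset_of_gap hM.isClosed hap' hclopen.isClosed h2 hg hxg hpast⟩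
  · refine ⟨covBy_iterate_of_forall_mem_gapRegion hM.isClosed h1 hx hxM hu hux n, ?_⟩
    rw [← gapRegion_symm] at hx'
    exact covBy_iterate_of_forall_mem_gapRegion hM.isClosed h2 hx' hxM hu hux n

/-! ### The decomposition -/

/-- The decomposition of a piecewise increasing homeomorphism of a compact ordered space. -/
theorem IsPiecewiseMono.exists_decomposition (hT : IsPiecewiseMono T)
    (hray : ∀ p : X, IsOpen (Ici p) ∨ IsOpen (Iic p)) :
    ∃ (k : ℕ) (C R : Fin k → Set X),
      (∀ i, (∃ q > 0, C i = {y | minimalPeriod T y = q}) ∨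
        (IsAperiodicMinimal T (C i) ∧ FollowsLeft T (R i) (C i))) ∧
      (∀ i, IsRegion T (R i) (C i)) ∧ (∀ i, (R i ∩ C i).Nonempty) ∧
      (Pairwise fun i j => Disjoint (R i) (R j)) ∧
      (∀ x, ∃ n, T^[n] x ∈ ⋃ i, R i) ∧ ∀ x, ∃ n, T.symm^[n] x ∈ ⋃ i, R i := by
  classical
  -- A fixed region `B M` bounds all regions used for `M`, so that `FollowsLeft` can be inherited:
  -- it passes to subsets of the region.
  have hB : ∀ M, ∃ B, IsAperiodicMinimal T M → M ⊆ B ∧ IsRegion T B M ∧ FollowsLeft T B M := by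
    intro M
    by_cases h : IsAperiodicMinimal T M
    · obtain ⟨R, hR⟩ := h.1.exists_isRegion hT h.2 hray
      exact ⟨R, fun _ => hR⟩
    · exact ⟨∅, fun h' => absurd h' h⟩
  choose B hB using hB
  have hnot : ∀ {M : Set X} {q : ℕ}, 0 < q → IsAperiodicMinimal T M →
      Disjoint {y | minimalPeriod T y = q} M := fun {M q} hq hM =>
    Set.disjoint_left.2 fun y hy hyM =>
      hM.2 y hyM (minimalPeriod_pos_iff_mem_periodicPts.1 (hq.trans_eq (Eq.symm hy)))
  let 𝒞 : Set (Set X) :=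
    {C | (∃ q > 0, C = {y | minimalPeriod T y = q}) ∨ IsAperiodicMinimal T C}
  have hdis : 𝒞.PairwiseDisjoint id := by
    rintro C₁ (⟨q, hq, rfl⟩ | h) C₂ (⟨q', hq', rfl⟩ | h') hne
    · refine Set.disjoint_left.2 fun y hy hy' => hne ?_
      obtain rfl : q = q' := Eq.trans (Eq.symm hy) hy'
      rfl
    · exact hnot hq h'
    · exact (hnot hq' h).symm
    · refine Set.disjoint_left.2 fun y hy hy' => hne (h.1.eq_of_inter_nonempty h'.1 ⟨y, hy, hy'⟩)
  have hα : ∀ x, ∃ C ∈ 𝒞, (T.symm.omegaSet x ∩ C).Nonempty := by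
    intro x
    obtain ⟨C, hC, h⟩ := exists_class_inter_omegaSet T.symm x
    refine ⟨C, hC.imp ?_ ?_, h⟩
    · rintro ⟨q, hq, rfl⟩
      exact ⟨q, hq, by simp only [minimalPeriod_symm]⟩
    · exact fun h => ⟨h.1.symm, IsMinimalSet.aperiodic_symm h.2⟩
  have hinv : ∀ C ∈ 𝒞, ∀ x ∈ C, T.omegaSet x ⊆ C ∧ T.symm.omegaSet x ⊆ C := by
    rintro C (⟨q, hq, rfl⟩ | h) x hx
    · refine ⟨omegaSet_subset_of_periodic hq hx, ?_⟩
      have := omegaSet_subset_of_periodic (T := T.symm) hq (minimalPeriod_symm.trans hx)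
      simpa only [minimalPeriod_symm] using this
    · exact ⟨(h.1.omegaSet_eq hx).le, (h.1.symm.omegaSet_eq hx).le⟩
  have hex : ∀ C ∈ 𝒞, ∀ x ∈ C, ∃ R, x ∈ R ∧
      R ⊆ (if IsAperiodicMinimal T C then B C else univ) ∧ IsRegion T R C := by
    rintro C (⟨q, hq, rfl⟩ | h) x hx
    · obtain ⟨R, hxR, hR⟩ := hT.exists_isRegion_of_periodic hray hq hx
      refine ⟨R, hxR, ?_, hR⟩
      rw [if_neg fun h => ?_]
      · exact subset_univ R
      · exact Set.disjoint_left.1 (hnot hq h) hx hx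
    · refine ⟨B C, (hB C h).1 hx, ?_, (hB C h).2.1⟩
      rw [if_pos h]
  obtain ⟨k, C, R, hC, hreg, hRB, hne, hdisj, h1, h2⟩ := exists_disjoint_regions T 𝒞
    (fun C => if IsAperiodicMinimal T C then B C else univ) hdis
    (fun x => exists_class_inter_omegaSet T x) hα hinv hex
  refine ⟨k, C, R, fun i => (hC i).imp_right fun h => ⟨h, fun x u hx hx' => ?_⟩, hreg, hne,
    hdisj, h1, h2⟩
  have hsub := hRB i
  rw [if_pos h] at hsub
  exact (hB _ h).2.2 x u (fun n => hsub (hx n)) fun n => hsub (hx' n)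

end Homeomorph

/-- The double arrow space of `[0, 1)`: every interior point is split into a left and a right
point. -/
@[ext]
structure DArrow where
  val : ℝ
  right : Bool
  mem : (right = true ∧ val ∈ Ico (0 : ℝ) 1) ∨ (right = false ∧ val ∈ Ioc (0 : ℝ) 1)

/-! ### Order, topology and compactness of the double arrow space. -/

namespace DArrow

/-- As `false < true`, the left point at `x` lies immediately below the right point. -/
noncomputable instance : LinearOrder DArrow :=
  LinearOrder.lift' (fun p => toLex (p.val, p.right)) fun p r h => by
    have := toLex.injective h
    simp only [Prod.mk.injEq] at this
    exact DArrow.ext this.1 this.2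

noncomputable instance : TopologicalSpace DArrow := Preorder.topology DArrow

instance : OrderTopology DArrow := ⟨rfl⟩

theorem lt_iff {p r : DArrow} :
    p < r ↔ p.val < r.val ∨ (p.val = r.val ∧ p.right = false ∧ r.right = true) := by
  change toLex (p.val, p.right) < toLex (r.val, r.right) ↔ _
  rw [Prod.Lex.toLex_lt_toLex]
  simp [Bool.lt_iff]

theorem le_iff {p r : DArrow} :
    p ≤ r ↔ p.val < r.val ∨ (p.val = r.val ∧ (r.right = false → p.right = false)) := by
  rw [← not_lt, lt_iff]
  rcases lt_trichotomy p.val r.val with h | h | h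
  · simp [h, h.not_gt, h.ne']
  · rw [h]; cases p.right <;> cases r.right <;> simp
  · simp [h, h.not_gt, h.ne']

/-- The right point at `x`. -/
def plus (x : ℝ) (hx : x ∈ Ico (0 : ℝ) 1) : DArrow := ⟨x, true, Or.inl ⟨rfl, hx⟩⟩

/-- The left point at `x`. -/
def minus (x : ℝ) (hx : x ∈ Ioc (0 : ℝ) 1) : DArrow := ⟨x, false, Or.inr ⟨rfl, hx⟩⟩

@[simp] theorem plus_val (x : ℝ) (hx) : (plus x hx).val = x := rfl
@[simp] theorem plus_right (x : ℝ) (hx) : (plus x hx).right = true := rfl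
@[simp] theorem minus_val (x : ℝ) (hx) : (minus x hx).val = x := rfl
@[simp] theorem minus_right (x : ℝ) (hx) : (minus x hx).right = false := rfl

theorem eq_plus_or_eq_minus (p : DArrow) : (∃ h, p = plus p.val h) ∨ ∃ h, p = minus p.val h :=
  p.mem.imp (fun h => ⟨h.2, DArrow.ext rfl h.1⟩) fun h => ⟨h.2, DArrow.ext rfl h.1⟩

theorem val_nonneg (p : DArrow) : 0 ≤ p.val := by
  rcases p.mem with h | h
  · exact h.2.1
  · exact h.2.1.le

theorem val_le_one (p : DArrow) : p.val ≤ 1 := by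
  rcases p.mem with h | h
  · exact h.2.2.le
  · exact h.2.2

/-- The points to the right of the cut between the left and the right point at `a`. -/
def up (a : ℝ) : Set DArrow := {p | a < p.val ∨ (p.val = a ∧ p.right = true)}

theorem isClopen_up (a : ℝ) : IsClopen (up a) := by
  rcases le_or_gt a 0 with h0 | h0
  · convert isClopen_univ
    refine eq_univ_of_forall fun p => ?_
    rcases p.mem with ⟨h, h'⟩ | ⟨h, h'⟩
    · rcases (h0.trans h'.1).eq_or_lt with he | hlt
      · exact Or.inr ⟨he.symm, h⟩
      · exact Or.inl hlt
    · exact Or.inl (h0.trans_lt h'.1)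
  rcases le_or_gt 1 a with h1 | h1
  · convert isClopen_empty
    refine eq_empty_of_forall_notMem fun p => ?_
    rintro (h | ⟨h, h'⟩)
    · exact (p.val_le_one.trans h1).not_gt h
    · rcases p.mem with ⟨-, h''⟩ | ⟨h'', -⟩
      · exact (h1.trans_eq h.symm).not_gt h''.2
      · rw [h'] at h''; exact absurd h'' (by decide)
  -- At an interior `a` the same set is the closed ray from the right point and the open ray above
  -- the left point.
  · have hp : a ∈ Ico (0 : ℝ) 1 := ⟨h0.le, h1⟩
    have hm : a ∈ Ioc (0 : ℝ) 1 := ⟨h0, h1.le⟩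
    constructor
    · convert isClosed_Ici (a := plus a hp)
      ext p
      rw [mem_Ici, le_iff]
      refine or_congr_right ?_
      cases p.right <;> simp [eq_comm (a := a)]
    · convert isOpen_Ioi (a := minus a hm)
      ext p
      rw [mem_Ioi, lt_iff]
      simp [up, eq_comm (a := a)]

/-- The points between `a` and `b`, with the right point at `a` and the left point at `b`. -/
def box (a b : ℝ) : Set DArrow :=
  {p | (p.right = true ∧ p.val ∈ Ico a b) ∨ (p.right = false ∧ p.val ∈ Ioc a b)}

theorem box_eq (a b : ℝ) : box a b = up a \ up b := by
  ext p
  simp only [box, up, Set.mem_sdiff, mem_ofPred_eq, mem_Ico, mem_Ioc]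
  cases p.right
  · simp
  · simp
    grind

theorem isClopen_box (a b : ℝ) : IsClopen (box a b) := by
  rw [box_eq]
  exact (isClopen_up a).diff (isClopen_up b)

theorem ordConnected_box (a b : ℝ) : OrdConnected (box a b) := by
  refine ⟨fun p hp r hr z hz => ?_⟩
  have h1 := le_iff.1 hz.1
  have h2 := le_iff.1 hz.2
  simp only [box, mem_ofPred_eq, mem_Ico, mem_Ioc] at *
  cases hp' : p.right <;> cases hr' : r.right <;> cases hz' : z.right <;>
    simp only [hp', hr', hz', reduceCtorEq, true_and, false_and, false_or, or_false] at * <;> grind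

theorem val_mem_Icc_of_mem_box {a b : ℝ} {p : DArrow} (h : p ∈ box a b) : p.val ∈ Icc a b :=
  h.elim (fun h => ⟨h.2.1, h.2.2.le⟩) fun h => ⟨h.2.1.le, h.2.2⟩

theorem isOpen_Ici_of_right {p : DArrow} (h : p.right = true) : IsOpen (Ici p) := by
  convert (isClopen_up p.val).isOpen
  ext r
  simp only [up, mem_ofPred_eq, mem_Ici, le_iff, h]
  refine or_congr_right ?_
  cases r.right <;> simp [eq_comm]

theorem isOpen_Iic_of_left {p : DArrow} (h : p.right = false) : IsOpen (Iic p) := by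
  convert (isClopen_up p.val).isClosed.isOpen_compl
  ext r
  simp only [up, mem_compl_iff, mem_ofPred_eq, mem_Iic, le_iff, h]
  cases r.right <;> simp <;> grind

theorem isOpen_Ici_or_isOpen_Iic (p : DArrow) : IsOpen (Ici p) ∨ IsOpen (Iic p) :=
  p.mem.imp (fun h => isOpen_Ici_of_right h.1) fun h => isOpen_Iic_of_left h.1

theorem continuous_val : Continuous val := by
  rw [OrderTopology.continuous_iff]
  intro a
  constructor
  · have : val ⁻¹' Ioi a = ⋃ b ∈ Ioi a, up b := by
      ext p
      simp only [mem_preimage, mem_Ioi, mem_iUnion, up, mem_ofPred_eq]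
      constructor
      · intro h
        exact ⟨(a + p.val) / 2, by linarith, Or.inl (by linarith)⟩
      · rintro ⟨b, hb, h | h⟩
        · exact lt_trans hb h
        · rw [h.1]; exact hb
    rw [this]
    exact isOpen_biUnion fun b _ => (isClopen_up b).isOpen
  · have : val ⁻¹' Iio a = ⋃ b ∈ Iio a, (up b)ᶜ := by
      ext p
      simp only [mem_preimage, mem_Iio, mem_iUnion, up, mem_ofPred_eq, mem_compl_iff]
      constructor
      · intro h
        exact ⟨(a + p.val) / 2, by linarith, by rintro (h | h) <;> linarith⟩
      · rintro ⟨b, hb, h⟩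
        by_contra! h'
        exact h (Or.inl (lt_of_lt_of_le hb h'))
    rw [this]
    exact isOpen_biUnion fun b _ => (isClopen_up b).isClosed.isOpen_compl

/-- The hypothesis is vacuous when there is no right point at `x`. The conclusion is then vacuous
for a suitable `b`, which lets fibres over any real `x` be treated uniformly. -/
theorem exists_right_of_mem_nhds {x : ℝ} {U : Set DArrow} (hU : ∀ h, U ∈ 𝓝 (plus x h)) :
    ∃ b > x, ∀ p : DArrow, x < p.val → p.val < b → p ∈ U := by
  rcases lt_or_ge x 0 with h0 | h0
  · exact ⟨0, h0, fun p _ hp => absurd p.val_nonneg hp.not_ge⟩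
  rcases lt_or_ge x 1 with h1 | h1
  · have hx : x ∈ Ico (0 : ℝ) 1 := ⟨h0, h1⟩
    obtain ⟨l, hl, hs⟩ := exists_Ico_subset_of_mem_nhds (hU hx)
      ⟨minus 1 ⟨one_pos, le_rfl⟩, lt_iff.2 (Or.inl h1)⟩
    have hlx : x < l.val := (lt_iff.1 hl).elim id fun h => absurd h.2.1 (by simp)
    exact ⟨l.val, hlx, fun p hp hpl =>
      hs ⟨le_iff.2 (Or.inl hp), lt_iff.2 (Or.inl hpl)⟩⟩
  · exact ⟨x + 1, by linarith, fun p hp _ => absurd p.val_le_one (by linarith)⟩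

theorem exists_left_of_mem_nhds {x : ℝ} {U : Set DArrow} (hU : ∀ h, U ∈ 𝓝 (minus x h)) :
    ∃ a < x, ∀ p : DArrow, a < p.val → p.val < x → p ∈ U := by
  rcases le_or_gt x 0 with h0 | h0
  · exact ⟨x - 1, by linarith, fun p _ hp => absurd p.val_nonneg (by linarith)⟩
  rcases le_or_gt x 1 with h1 | h1
  · have hx : x ∈ Ioc (0 : ℝ) 1 := ⟨h0, h1⟩
    obtain ⟨l, hl, hs⟩ := exists_Ioc_subset_of_mem_nhds (hU hx)
      ⟨plus 0 ⟨le_rfl, one_pos⟩, lt_iff.2 (Or.inl h0)⟩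
    have hlx : l.val < x := (lt_iff.1 hl).elim id fun h => absurd h.2.2 (by simp)
    exact ⟨l.val, hlx, fun p hp hpl =>
      hs ⟨lt_iff.2 (Or.inl hp), le_iff.2 (Or.inl hpl)⟩⟩
  · exact ⟨1, h1, fun p hp _ => absurd p.val_le_one (by linarith)⟩

/-- A neighbourhood of a fibre of `val` contains the preimage of a neighbourhood. -/
theorem exists_preimage_subset {x : ℝ} {U : Set DArrow} (hU : ∀ p : DArrow, p.val = x → U ∈ 𝓝 p) :
    ∃ V ∈ 𝓝 x, val ⁻¹' V ⊆ U := by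
  obtain ⟨b, hb, hb'⟩ := exists_right_of_mem_nhds fun h => hU (plus x h) rfl
  obtain ⟨a, ha, ha'⟩ := exists_left_of_mem_nhds fun h => hU (minus x h) rfl
  refine ⟨Ioo a b, Ioo_mem_nhds ha hb, fun p hp => ?_⟩
  rcases lt_trichotomy p.val x with h | h | h
  · exact ha' p hp.1 h
  · exact mem_of_mem_nhds (hU p h)
  · exact hb' p h hp.2

theorem finite_fiber (x : ℝ) : {p : DArrow | p.val = x}.Finite := by
  refine Finite.of_finite_image (f := right) (toFinite _) fun p hp r hr h => ?_
  exact DArrow.ext (Eq.trans hp (Eq.symm hr)) h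

/-- The real coordinates of an ultrafilter converge to some `x`. If no point over `x` were a limit,
the finitely many neighbourhoods of these points would cover a set of the ultrafilter, so one of
them would belong to it. -/
instance : CompactSpace DArrow := by
  refine ⟨isCompact_iff_ultrafilter_le_nhds.2 fun F _ => ?_⟩
  obtain ⟨x, -, hx⟩ := isCompact_iff_ultrafilter_le_nhds.1 (isCompact_Icc (a := (0 : ℝ)) (b := 1))
    (F.map val) (by
      rw [le_principal_iff]
      exact F.univ_mem' fun p => (⟨p.val_nonneg, p.val_le_one⟩ : p.val ∈ Icc (0 : ℝ) 1))
  by_contra! hF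
  have hex : ∀ p : DArrow, ∃ U ∈ 𝓝 p, U ∉ F := fun p => by
    have := hF p (mem_univ p)
    rw [Filter.le_def] at this
    push Not at this
    exact this
  choose U hU hUF using hex
  obtain ⟨V, hV, hVU⟩ := exists_preimage_subset (x := x) (U := ⋃ p ∈ {p : DArrow | p.val = x}, U p)
    fun p hp => mem_of_superset (hU p) (subset_biUnion_of_mem (u := U) hp)
  have hmem : (⋃ p ∈ {p : DArrow | p.val = x}, U p) ∈ F := mem_of_superset (hx hV) hVU
  obtain ⟨p, -, hp⟩ := (Ultrafilter.finite_biUnion_mem_iff (finite_fiber x)).1 hmem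
  exact hUF p hp

/-! ### Clopen sets and right-open unions -/

/-- The real points whose right point belongs to `K`. -/
def real (K : Set DArrow) : Set ℝ := {x | ∃ h, plus x h ∈ K}

theorem exists_box_mem_nhds {K : Set DArrow} {p : DArrow} (hK : K ∈ 𝓝 p) :
    ∃ a b, box a b ∈ 𝓝 p ∧ box a b ⊆ K ∧ 0 ≤ a ∧ b ≤ 1 := by
  rcases p.eq_plus_or_eq_minus with ⟨h, hp⟩ | ⟨h, hp⟩
  · obtain ⟨b, hb, hs⟩ := exists_right_of_mem_nhds (x := p.val) fun h' => hp ▸ hK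
    -- The midpoint is needed because a box contains the left point at its right end, whose value
    -- must stay below `b`.
    refine ⟨p.val, min 1 ((p.val + b) / 2), (isClopen_box _ _).isOpen.mem_nhds ?_, fun r hr => ?_,
      h.1, min_le_left _ _⟩
    · rw [hp]
      exact Or.inl ⟨rfl, le_rfl, lt_min h.2 (by simp only [plus_val]; linarith)⟩
    · have h1 := val_mem_Icc_of_mem_box hr
      rcases h1.1.eq_or_lt with he | hlt
      · have : r = p := by
          refine DArrow.ext he.symm ?_
          rw [hp]
          rcases hr with hr | hr
          · exact hr.1
          · exact absurd he hr.2.1.ne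
        rw [this]
        exact mem_of_mem_nhds hK
      · exact hs r hlt (lt_of_le_of_lt (h1.2.trans (min_le_right _ _)) (by linarith))
  · obtain ⟨a, ha, hs⟩ := exists_left_of_mem_nhds (x := p.val) fun h' => hp ▸ hK
    refine ⟨max 0 ((a + p.val) / 2), p.val, (isClopen_box _ _).isOpen.mem_nhds ?_, fun r hr => ?_,
      le_max_left _ _, h.2⟩
    · rw [hp]
      exact Or.inr ⟨rfl, max_lt h.1 (by simp only [minus_val]; linarith), le_rfl⟩
    · have h1 := val_mem_Icc_of_mem_box hr
      rcases h1.2.eq_or_lt with he | hlt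
      · have : r = p := by
          refine DArrow.ext he ?_
          rw [hp]
          rcases hr with hr | hr
          · exact absurd he hr.2.2.ne
          · exact hr.1
        rw [this]
        exact mem_of_mem_nhds hK
      · exact hs r (lt_of_lt_of_le (by linarith) ((le_max_right _ _).trans h1.1)) hlt

theorem isRightOpenUnion_real {K : Set DArrow} (hK : IsClopen K) : IsRightOpenUnion (real K) := by
  classical
  have hex : ∀ p : DArrow, ∃ a b, p ∈ K → box a b ∈ 𝓝 p ∧ box a b ⊆ K ∧ 0 ≤ a ∧ b ≤ 1 := by
    intro p
    by_cases hp : p ∈ K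
    · obtain ⟨a, b, h⟩ := exists_box_mem_nhds (hK.isOpen.mem_nhds hp)
      exact ⟨a, b, fun _ => h⟩
    · exact ⟨0, 0, fun h => absurd h hp⟩
  choose a b hab using hex
  obtain ⟨t, ht, hcov⟩ := hK.isClosed.isCompact.elim_nhds_subcover (fun p => box (a p) (b p))
    fun p hp => (hab p hp).1
  refine ⟨t.image fun p => (a p, b p), ?_⟩
  ext x
  simp only [real, mem_ofPred_eq, Finset.mem_image, mem_iUnion, exists_prop]
  constructor
  · rintro ⟨h, hx⟩
    obtain ⟨p, hp, hxp⟩ := mem_iUnion₂.1 (hcov hx)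
    exact ⟨_, ⟨p, hp, rfl⟩, hxp.elim (fun h => h.2) fun h => by simp at h⟩
  · rintro ⟨_, ⟨p, hp, rfl⟩, hx⟩
    obtain ⟨-, h1, h2, h3⟩ := hab p (ht p hp)
    exact ⟨⟨h2.trans hx.1, hx.2.trans_le h3⟩, h1 (Or.inl ⟨rfl, hx⟩)⟩

/-- Both `K` and its complement are open, so the left point at `x` has the same membership as the
points just below `x`. This identifies the domain of `leftOpen` with the left points of `K`. -/
theorem minus_mem_iff {K : Set DArrow} (hK : IsClopen K) {x : ℝ} :
    (∃ h, minus x h ∈ K) ↔ ∀ᶠ z in 𝓝[<] x, z ∈ real K := by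
  have key : ∀ {K : Set DArrow}, IsOpen K → ∀ {h}, minus x h ∈ K → ∀ᶠ z in 𝓝[<] x, z ∈ real K := by
    intro K hK h hx
    obtain ⟨a, ha, hs⟩ := exists_left_of_mem_nhds (x := x) fun _ => hK.mem_nhds hx
    filter_upwards [Ioo_mem_nhdsLT (max_lt ha h.1)] with z hz
    have hz0 : z ∈ Ico (0 : ℝ) 1 :=
      ⟨((le_max_right _ _).trans_lt hz.1).le, hz.2.trans_le h.2⟩
    exact ⟨hz0, hs _ ((le_max_left _ _).trans_lt hz.1) hz.2⟩
  refine ⟨fun ⟨h, hx⟩ => key hK.isOpen hx, fun hev => ?_⟩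
  have h0 : x ∈ Ioc (0 : ℝ) 1 := by
    constructor
    · obtain ⟨z, ⟨h, -⟩, hz⟩ := (hev.and self_mem_nhdsWithin).exists
      exact lt_of_le_of_lt h.1 hz
    · by_contra! h
      obtain ⟨z, ⟨h', -⟩, hz⟩ := (hev.and (Ioo_mem_nhdsLT h)).exists
      exact h'.2.not_gt hz.1
  refine ⟨h0, ?_⟩
  by_contra hx
  obtain ⟨z, ⟨h1, h2⟩, h3, h4⟩ := (hev.and (key hK.isClosed.isOpen_compl (h := h0) hx)).exists
  exact h4 h2

theorem val_eq_of_covBy {p r : DArrow} (h : p ⋖ r) : p.val = r.val := by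
  rcases lt_iff.1 h.1 with hlt | h'
  · exfalso
    have hm : (p.val + r.val) / 2 ∈ Ico (0 : ℝ) 1 :=
      ⟨by linarith [p.val_nonneg, r.val_nonneg], by linarith [r.val_le_one]⟩
    exact h.2 (c := plus _ hm) (lt_iff.2 (Or.inl (by simp only [plus_val]; linarith)))
      (lt_iff.2 (Or.inl (by simp only [plus_val]; linarith)))
  · exact h'.1

theorem minus_covBy_plus {x : ℝ} (h h') : minus x h ⋖ plus x h' := by
  refine ⟨lt_iff.2 (Or.inr ⟨rfl, rfl, rfl⟩), fun c h1 h2 => ?_⟩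
  rw [lt_iff] at h1 h2
  simp only [minus_val, minus_right, plus_val, plus_right, true_and, and_true] at h1 h2
  grind

end DArrow

/-- A bijection which is locally increasing with locally convex images is continuous. -/
theorem continuous_of_forall_exists_strictMonoOn {X : Type*} [LinearOrder X] [TopologicalSpace X]
    [OrderTopology X] {f : X → X} (hf : Bijective f)
    (h : ∀ x, ∃ K, IsOpen K ∧ x ∈ K ∧ StrictMonoOn f K ∧ OrdConnected (f '' K)) :
    Continuous f := by
  rw [OrderTopology.continuous_iff]
  intro a
  obtain ⟨a, rfl⟩ := hf.2 a
  have hout : ∀ K : Set X, a ∉ K → f a ∉ f '' K := fun K ha ⟨b, hb, hba⟩ => ha (hf.1 hba ▸ hb)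
  constructor <;> rw [isOpen_iff_mem_nhds] <;> intro x hx <;> obtain ⟨K, hK, hxK, hm, hc⟩ := h x <;>
    by_cases ha : a ∈ K
  · filter_upwards [hK.mem_nhds hxK, isOpen_Ioi.mem_nhds ((hm.lt_iff_lt ha hxK).1 hx)] with z hz hz'
    exact hm ha hz hz'
  -- The image of `K` is an interval missing `f a`, so it lies on one side of `f a`.
  · filter_upwards [hK.mem_nhds hxK] with z hz
    by_contra hlt
    exact hout K ha (hc.out (mem_image_of_mem f hz) (mem_image_of_mem f hxK)
      ⟨not_lt.1 hlt, le_of_lt hx⟩)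
  · filter_upwards [hK.mem_nhds hxK, isOpen_Iio.mem_nhds ((hm.lt_iff_lt hxK ha).1 hx)] with z hz hz'
    exact hm hz ha hz'
  · filter_upwards [hK.mem_nhds hxK] with z hz
    by_contra hlt
    exact hout K ha (hc.out (mem_image_of_mem f hxK) (mem_image_of_mem f hz)
      ⟨le_of_lt hx, not_lt.1 hlt⟩)

/-! ### Interval partitions of `[0, 1)` lifted to boxes. -/

section IntervalPartition

variable {ι : Type*} {l r : ι → ℝ}

/-- Take the interval with the largest left endpoint below `x`. If it ended before `x`, the interval
containing its right endpoint would start no later and overlap it. -/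
theorem exists_mem_Ioc_of_iUnion_Ico [Finite ι] (hlr : ∀ i, l i < r i)
    (hdisj : Pairwise fun i j => Disjoint (Ico (l i) (r i)) (Ico (l j) (r j)))
    (hU : ⋃ i, Ico (l i) (r i) = Ico 0 1) {x : ℝ} (hx : x ∈ Ioc (0 : ℝ) 1) :
    ∃ i, x ∈ Ioc (l i) (r i) := by
  have h0 : (0 : ℝ) ∈ ⋃ i, Ico (l i) (r i) := by rw [hU]; exact ⟨le_rfl, one_pos⟩
  obtain ⟨i₀, hi₀⟩ := mem_iUnion.1 h0
  obtain ⟨i, hi, hmax⟩ := (toFinite {i | l i < x}).exists_maximalFor l _ ⟨i₀, hi₀.1.trans_lt hx.1⟩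
  refine ⟨i, hi, not_lt.1 fun hlt => ?_⟩
  have hri : r i ∈ ⋃ i, Ico (l i) (r i) := by
    have : l i ∈ ⋃ i, Ico (l i) (r i) := mem_iUnion.2 ⟨i, le_rfl, hlr i⟩
    rw [hU] at this ⊢
    exact ⟨this.1.trans (hlr i).le, hlt.trans_le hx.2⟩
  obtain ⟨j, hj⟩ := mem_iUnion.1 hri
  have hji : l j ≤ l i := by
    rcases le_total (l j) (l i) with h | h
    · exact h
    · exact hmax (hj.1.trans_lt hlt) h
  have hij : i ≠ j := fun h => hj.2.ne (by rw [h])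
  exact (hdisj hij).le_bot ⟨⟨le_rfl, hlr i⟩, hji, (hlr i).trans hj.2⟩

theorem exists_mem_box_of_iUnion_Ico [Finite ι] (hlr : ∀ i, l i < r i)
    (hdisj : Pairwise fun i j => Disjoint (Ico (l i) (r i)) (Ico (l j) (r j)))
    (hU : ⋃ i, Ico (l i) (r i) = Ico 0 1) (p : DArrow) : ∃ i, p ∈ DArrow.box (l i) (r i) := by
  rcases p.mem with ⟨h, hp⟩ | ⟨h, hp⟩
  · rw [← hU] at hp
    obtain ⟨i, hi⟩ := mem_iUnion.1 hp
    exact ⟨i, Or.inl ⟨h, hi⟩⟩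
  · obtain ⟨i, hi⟩ := exists_mem_Ioc_of_iUnion_Ico hlr hdisj hU hp
    exact ⟨i, Or.inr ⟨h, hi⟩⟩

theorem eq_of_mem_box
    (hdisj : Pairwise fun i j => Disjoint (Ico (l i) (r i)) (Ico (l j) (r j)))
    {p : DArrow} {i j : ι} (hi : p ∈ DArrow.box (l i) (r i)) (hj : p ∈ DArrow.box (l j) (r j)) :
    i = j := by
  by_contra hij
  rcases hi with ⟨h, hi⟩ | ⟨h, hi⟩ <;> rcases hj with ⟨h', hj⟩ | ⟨h', hj⟩
  · exact (hdisj hij).le_bot ⟨hi, hj⟩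
  · simp [h] at h'
  · simp [h] at h'
  · obtain ⟨z, hz1, hz2⟩ := exists_between (max_lt hi.1 hj.1)
    exact (hdisj hij).le_bot ⟨⟨((le_max_left _ _).trans_lt hz1).le, hz2.trans_le hi.2⟩,
      ((le_max_right _ _).trans_lt hz1).le, hz2.trans_le hj.2⟩

theorem DArrow.mem_of_mem_box {a b x : ℝ} {s : Bool} (hab : a < b) (h : Ico a b ⊆ Ico 0 1)
    (hx : (s = true ∧ x ∈ Ico a b) ∨ (s = false ∧ x ∈ Ioc a b)) :
    (s = true ∧ x ∈ Ico (0 : ℝ) 1) ∨ (s = false ∧ x ∈ Ioc (0 : ℝ) 1) := by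
  obtain ⟨h1, h2⟩ := (Ico_subset_Ico_iff hab).1 h
  exact hx.imp (fun h' => ⟨h'.1, h h'.2⟩) fun h' => ⟨h'.1, Ioc_subset_Ioc h1 h2 h'.2⟩

end IntervalPartition

/-! ### The homeomorphism of the double arrow space induced by a GIET. -/

namespace GGIET

open DArrow

variable {r : WithTop ℕ∞} {d : ℕ} (T : GGIET r d)

/-- The value of `T` at a right point, and its left limit at a left point. -/
noncomputable def hatVal (p : DArrow) : ℝ :=
  if p.right = true then T.toFun p.val else leftLim T.toFun p.val

/-- The extension `g` to the closed interval describes the induced map on the whole box: at left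
points, including the right end, `leftLim` is computed by the continuity of `g`. -/
theorem exists_branch (α : Fin d) : ∃ g h : ℝ → ℝ,
    StrictMonoOn g (Icc (T.topL α) (T.topR α)) ∧
    g (T.topL α) = T.botL α ∧ g (T.topR α) = T.botR α ∧
    (∀ y ∈ Icc (T.botL α) (T.botR α), h y ∈ Icc (T.topL α) (T.topR α) ∧ g (h y) = y) ∧
    ∀ p ∈ box (T.topL α) (T.topR α), T.hatVal p = g p.val := by
  obtain ⟨g, h, hg, hh, hinv, hm, hgc, -, heq⟩ := T.branch α
  have hl : T.topL α ∈ Icc (T.topL α) (T.topR α) := left_mem_Icc.2 (T.top_lt α).le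
  have hr : T.topR α ∈ Icc (T.topL α) (T.topR α) := right_mem_Icc.2 (T.top_lt α).le
  have hl' : T.botL α ∈ Icc (T.botL α) (T.botR α) := left_mem_Icc.2 (T.bot_lt α).le
  have hr' : T.botR α ∈ Icc (T.botL α) (T.botR α) := right_mem_Icc.2 (T.bot_lt α).le
  refine ⟨g, h, hm, ?_, ?_, fun y hy => ⟨hh hy, hinv.2 hy⟩, fun p hp => ?_⟩
  · refine le_antisymm ?_ (hg hl).1
    rw [← hinv.2 hl', hm.le_iff_le hl (hh hl')]
    exact (hh hl').1
  · refine le_antisymm (hg hr).2 ?_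
    rw [← hinv.2 hr', hm.le_iff_le (hh hr') hr]
    exact (hh hr').2
  · rcases hp with ⟨hs, hp⟩ | ⟨hs, hp⟩
    · rw [hatVal, if_pos hs]
      exact heq hp
    · rw [hatVal, if_neg (by simp [hs])]
      refine leftLim_eq_of_tendsto ?_
      have hc : Tendsto g (𝓝[Icc (T.topL α) (T.topR α)] p.val) (𝓝 (g p.val)) :=
        hgc.continuousOn _ ⟨hp.1.le, hp.2⟩
      have hev : ∀ᶠ z in 𝓝[<] p.val, z ∈ Ico (T.topL α) (T.topR α) := by
        filter_upwards [Ioo_mem_nhdsLT hp.1] with z hz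
        exact ⟨hz.1.le, hz.2.trans_le hp.2⟩
      have hle : 𝓝[<] p.val ≤ 𝓝[Icc (T.topL α) (T.topR α)] p.val :=
        le_inf nhdsWithin_le_nhds (le_principal_iff.2 (hev.mono fun z hz => Ico_subset_Icc_self hz))
      exact (hc.mono_left hle).congr' (hev.mono fun z hz => (heq hz).symm)

theorem hatVal_mem {α : Fin d} {p : DArrow} (hp : p ∈ box (T.topL α) (T.topR α)) :
    (p.right = true ∧ T.hatVal p ∈ Ico (T.botL α) (T.botR α)) ∨
      (p.right = false ∧ T.hatVal p ∈ Ioc (T.botL α) (T.botR α)) := by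
  obtain ⟨g, h, hm, hl, hr, -, hval⟩ := T.exists_branch α
  rw [hval p hp]
  have hL : T.topL α ∈ Icc (T.topL α) (T.topR α) := left_mem_Icc.2 (T.top_lt α).le
  have hR : T.topR α ∈ Icc (T.topL α) (T.topR α) := right_mem_Icc.2 (T.top_lt α).le
  have hpI := val_mem_Icc_of_mem_box hp
  rw [← hl, ← hr]
  refine hp.imp (fun h => ⟨h.1, ?_, ?_⟩) fun h => ⟨h.1, ?_, ?_⟩
  · exact (hm.le_iff_le hL hpI).2 h.2.1
  · exact hm hpI hR h.2.2
  · exact hm hL hpI h.2.1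
  · exact (hm.le_iff_le hpI hR).2 h.2.2

variable {T}

theorem exists_mem_top_box (hT : T.IsGIET) (p : DArrow) : ∃ α, p ∈ box (T.topL α) (T.topR α) :=
  exists_mem_box_of_iUnion_Ico T.top_lt T.top_disjoint hT.1 p

/-- The map induced by a GIET on the double arrow space. -/
noncomputable def hatFun (hT : T.IsGIET) (p : DArrow) : DArrow where
  val := T.hatVal p
  right := p.right
  mem := by
    obtain ⟨α, hα⟩ := exists_mem_top_box hT p
    exact mem_of_mem_box (T.bot_lt α) (T.bot_subset α) (T.hatVal_mem hα)

theorem strictMonoOn_hatFun (hT : T.IsGIET) (α : Fin d) :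
    StrictMonoOn (hatFun hT) (box (T.topL α) (T.topR α)) := by
  obtain ⟨g, h, hm, -, -, -, hval⟩ := T.exists_branch α
  intro p hp s hs hps
  rw [DArrow.lt_iff] at hps ⊢
  simp only [hatFun, hval p hp, hval s hs]
  exact hps.imp (fun h => hm (val_mem_Icc_of_mem_box hp) (val_mem_Icc_of_mem_box hs) h)
    fun h => ⟨by rw [h.1], h.2⟩

theorem image_hatFun (hT : T.IsGIET) (α : Fin d) :
    hatFun hT '' box (T.topL α) (T.topR α) = box (T.botL α) (T.botR α) := by
  apply Subset.antisymm
  · rintro _ ⟨p, hp, rfl⟩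
    exact T.hatVal_mem hp
  · intro s hs
    obtain ⟨g, h, hm, hl, hr, hinv, hval⟩ := T.exists_branch α
    obtain ⟨hI, hgh⟩ := hinv s.val (val_mem_Icc_of_mem_box hs)
    have hL : T.topL α ∈ Icc (T.topL α) (T.topR α) := left_mem_Icc.2 (T.top_lt α).le
    have hR : T.topR α ∈ Icc (T.topL α) (T.topR α) := right_mem_Icc.2 (T.top_lt α).le
    have hbox : (s.right = true ∧ h s.val ∈ Ico (T.topL α) (T.topR α)) ∨
        (s.right = false ∧ h s.val ∈ Ioc (T.topL α) (T.topR α)) := by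
      refine hs.imp (fun hs => ⟨hs.1, hI.1, ?_⟩) fun hs => ⟨hs.1, ?_, hI.2⟩
      · rw [← hm.lt_iff_lt hI hR, hgh, hr]
        exact hs.2.2
      · rw [← hm.lt_iff_lt hL hI, hgh, hl]
        exact hs.2.1
    let p : DArrow := ⟨h s.val, s.right, mem_of_mem_box (T.top_lt α) (T.top_subset α) hbox⟩
    have hp : p ∈ box (T.topL α) (T.topR α) := hbox
    exact ⟨p, hp, DArrow.ext ((hval p hp).trans hgh) rfl⟩

theorem bijective_hatFun (hT : T.IsGIET) : Bijective (hatFun hT) := by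
  constructor
  · intro p s hps
    obtain ⟨α, hα⟩ := exists_mem_top_box hT p
    obtain ⟨β, hβ⟩ := exists_mem_top_box hT s
    have h1 : hatFun hT p ∈ box (T.botL α) (T.botR α) := T.hatVal_mem hα
    have h2 : hatFun hT s ∈ box (T.botL β) (T.botR β) := T.hatVal_mem hβ
    rw [← hps] at h2
    obtain rfl := eq_of_mem_box T.bot_disjoint h1 h2
    exact (strictMonoOn_hatFun hT α).injOn hα hβ hps
  · intro s
    obtain ⟨α, hα⟩ := exists_mem_box_of_iUnion_Ico T.bot_lt T.bot_disjoint hT.2 s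
    rw [← image_hatFun hT α] at hα
    obtain ⟨p, -, hp⟩ := hα
    exact ⟨p, hp⟩

theorem ordConnected_image_hatFun (hT : T.IsGIET) (α : Fin d) :
    OrdConnected (hatFun hT '' box (T.topL α) (T.topR α)) := by
  rw [image_hatFun]
  exact ordConnected_box _ _

/-- The homeomorphism of the double arrow space induced by a GIET. -/
noncomputable def hat (hT : T.IsGIET) : DArrow ≃ₜ DArrow :=
  Continuous.homeoOfEquivCompactToT2 (f := Equiv.ofBijective _ (bijective_hatFun hT))
    (continuous_of_forall_exists_strictMonoOn (bijective_hatFun hT) fun p => by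
      obtain ⟨α, hα⟩ := exists_mem_top_box hT p
      exact ⟨_, (isClopen_box _ _).isOpen, hα, strictMonoOn_hatFun hT α,
        ordConnected_image_hatFun hT α⟩)

theorem hat_apply (hT : T.IsGIET) (p : DArrow) : hat hT p = hatFun hT p := rfl

theorem isPiecewiseMono_hat (hT : T.IsGIET) : (hat hT).IsPiecewiseMono := by
  refine ⟨range fun α => box (T.topL α) (T.topR α), finite_range _, ?_, fun p => ?_⟩
  · rintro _ ⟨α, rfl⟩
    exact ⟨(isClopen_box _ _).isOpen, ordConnected_box _ _, strictMonoOn_hatFun hT α,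
      ordConnected_image_hatFun hT α⟩
  · obtain ⟨α, hα⟩ := exists_mem_top_box hT p
    exact ⟨_, mem_range_self α, hα⟩

end GGIET

/-- A cyclic sequence of points realizes a periodic orbit. -/
theorem PMap.isPeriodicOfPeriod_of_seq {S : PMap} (hS : InjOn S.toFun S.dom) {a : ℕ → ℝ} {q : ℕ}
    (hq : 0 < q) (hdom : ∀ k, a k ∈ S.dom) (hstep : ∀ k, S.toFun (a k) = a (k + 1))
    (hper : ∀ k, a (k + q) = a k) (hinj : InjOn a (Iio q)) : S.IsPeriodicOfPeriod q (a 0) := by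
  have hiter : ∀ n, S.toFun^[n] (a 0) = a n := by
    intro n
    induction n with
    | zero => rfl
    | succ n ih => rw [iterate_succ_apply', ih, hstep]
  have hprev : ∀ k, S.toFun (a (k + q - 1)) = a k := fun k => by
    rw [hstep, Nat.sub_add_cancel (by omega), hper]
  -- Injectivity forces every backward orbit to run through the cyclic sequence.
  have hback : ∀ n m y, y ∈ S.domIter n → S.toFun^[n] y = a m → ∃ j, a j = y := by
    intro n
    induction n with
    | zero => exact fun m y _ hy => ⟨m, hy.symm⟩
    | succ n ih =>
      intro m y hy hym
      rw [iterate_succ_apply', ← hprev m] at hym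
      exact ih _ y (fun k hk => hy k (by omega)) (hS (hy n n.lt_succ_self) (hdom _) hym)
  have hmod : ∀ n, a n = a (n % q) := by
    intro n
    have : ∀ k m, a (m + q * k) = a m := by
      intro k m
      induction k with
      | zero => simp
      | succ k ih => rw [mul_add, mul_one, ← add_assoc, hper, ih]
    conv_lhs => rw [← Nat.mod_add_div n q]
    exact this _ _
  have horb : S.orbit (a 0) = a '' Iio q := by
    apply Subset.antisymm
    · have : ∀ j, a j ∈ a '' Iio q := fun j => ⟨j % q, Nat.mod_lt j hq, (hmod j).symm⟩
      rintro y (⟨n, -, rfl⟩ | ⟨n, hy, hyn⟩)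
      · rw [hiter]
        exact this n
      · obtain ⟨j, rfl⟩ := hback n 0 y hy hyn
        exact this j
    · rintro _ ⟨n, -, rfl⟩
      exact Or.inl ⟨n, fun k _ => by rw [hiter]; exact hdom k, hiter n⟩
  refine ⟨⟨?_, ?_⟩, ?_⟩
  · rw [horb]
    rintro _ ⟨n, -, rfl⟩
    exact ⟨hdom n, _, hdom _, hprev n⟩
  · rw [horb]
    exact (finite_Iio q).image a
  · rw [horb, hinj.ncard_image, ncard_eq_toFinset_card']
    simp

/-! ### Periodic orbits and minimal sets inside regions. -/

namespace Homeomorph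

variable {X : Type*} [TopologicalSpace X] {T : X ≃ₜ X} {R C : Set X} {p : X}

theorem IsRegion.iterate_mem_of_periodic {q : ℕ} (hq : 0 < q) (hp : IsPeriodicPt T q p)
    (hR : IsRegion T R C) (hpR : p ∈ R) (n : ℕ) : T^[n] p ∈ R := by
  rcases hR.stays p hpR with ⟨h, -⟩ | ⟨h, -⟩
  · exact h n
  -- By periodicity the future iterate at time `n` is the past iterate at time `q * n - n`.
  · have h1 := h (q * n - n)
    rw [symm_iterate_eq_of_periodic (Nat.sub_le _ _) (hp.mul_const n),
      Nat.sub_sub_self (Nat.le_mul_of_pos_left n hq)] at h1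
    exact h1

theorem IsRegion.subset_of_inter_nonempty [CompactSpace X] {M : Set X} (hM : IsMinimalSet T M)
    (hR : IsRegion T R C) (h : (R ∩ M).Nonempty) : M ⊆ R := by
  obtain ⟨p, hpR, hpM⟩ := h
  rcases hR.stays p hpR with ⟨h, -⟩ | ⟨h, -⟩
  · rw [← hM.omegaSet_eq hpM]
    exact omegaSet_subset_of_forall_mem hR.isClopen.isClosed h
  · rw [← hM.symm.omegaSet_eq hpM]
    exact omegaSet_subset_of_forall_mem hR.isClopen.isClosed h

theorem closure_orbit_eq [CompactSpace X] {M : Set X} (hM : IsMinimalSet T M) (hp : p ∈ M) :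
    closure (range (fun n => T^[n] p) ∪ range fun n => T.symm^[n] p) = M := by
  apply Subset.antisymm
  · refine closure_minimal ?_ hM.isClosed
    rintro _ (⟨n, rfl⟩ | ⟨n, rfl⟩)
    · exact hM.mapsTo.iterate n hp
    · exact hM.symm_mapsTo.iterate n hp
  · conv_lhs => rw [← hM.omegaSet_eq hp]
    exact omegaSet_subset_of_forall_mem isClosed_closure fun n =>
      subset_closure (Or.inl ⟨n, rfl⟩)

end Homeomorph

/-- Compactness lifts accumulation from the line to the double arrow space, but does not say which
of the two copies of `x` is reached. -/
theorem DArrow.exists_mem_omegaSet_of_val {F : DArrow ≃ₜ DArrow} {p : DArrow} {x : ℝ}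
    (h : ∀ U ∈ 𝓝 x, ∀ N : ℕ, ∃ n ≥ N, (F^[n] p).val ∈ U) :
    ∃ p' : DArrow, p'.val = x ∧ p' ∈ F.omegaSet p := by
  have hcl : MapClusterPt x atTop fun n : ℕ => (F^[n] p).val := by
    simp only [mapClusterPt_iff_frequently, frequently_atTop]
    exact h
  obtain ⟨U, hU, hlim⟩ := mapClusterPt_iff_ultrafilter.1 hcl
  obtain ⟨p', -, hp'⟩ := isCompact_iff_ultrafilter_le_nhds.1 (isCompact_univ (X := DArrow))
    (U.map fun n : ℕ => F^[n] p) (by simp)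
  refine ⟨p', ?_, mapClusterPt_iff_ultrafilter.2 ⟨U, hU, hp'⟩⟩
  exact tendsto_nhds_unique ((continuous_val.tendsto p').comp hp') hlim

/-! ### Orbits of the restricted GIET in terms of the induced homeomorphism. -/

namespace GGIET

open DArrow Homeomorph

variable {r : WithTop ℕ∞} {d : ℕ} {T : GGIET r d} {hT : T.IsGIET} {R C : Set DArrow} {p : DArrow}

theorem right_iterate_hat (n : ℕ) (p : DArrow) : ((hat hT)^[n] p).right = p.right := by
  induction n with
  | zero => rfl
  | succ n ih => rw [iterate_succ_apply', ← ih]; rfl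

theorem right_symm_iterate_hat (n : ℕ) (p : DArrow) : ((hat hT).symm^[n] p).right = p.right := by
  conv_rhs => rw [← iterate_symm_iterate (hat hT) n p, right_iterate_hat]

theorem val_hat_of_right (hp : p.right = true) : (hat hT p).val = T.toFun p.val := by
  rw [hat_apply]
  exact if_pos hp

theorem val_hat_of_left (hp : p.right = false) : (hat hT p).val = leftLim T.toFun p.val := by
  rw [hat_apply]
  exact if_neg (by simp [hp])

theorem val_iterate_hat (hp : p.right = true) (n : ℕ) :
    ((hat hT)^[n] p).val = T.toFun^[n] p.val := by
  induction n with
  | zero => rfl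
  | succ n ih =>
    rw [iterate_succ_apply', iterate_succ_apply', ← ih, val_hat_of_right]
    rw [right_iterate_hat, hp]

theorem val_mem_real (hp : p.right = true) : p.val ∈ real R ↔ p ∈ R := by
  rcases p.eq_plus_or_eq_minus with ⟨h, he⟩ | ⟨h, he⟩
  · constructor
    · rintro ⟨h', hR⟩
      rw [he]
      exact hR
    · intro hR
      exact ⟨h, he ▸ hR⟩
  · rw [he] at hp
    exact absurd hp (by simp)

theorem exists_of_mem_real {x : ℝ} (hx : x ∈ real R) : ∃ p ∈ R, p.right = true ∧ p.val = x := by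
  obtain ⟨h, hR⟩ := hx
  exact ⟨_, hR, rfl, rfl⟩

theorem dom_restrict (hT : T.IsGIET) : (T.toPMap.restrict (real R)).dom = real R := by
  refine inter_eq_right.2 fun x hx => ?_
  obtain ⟨h, -⟩ := hx
  change x ∈ T.top
  rw [hT.1]
  exact h

theorem val_mem_domIter (hT : T.IsGIET) (hp : p.right = true) {n : ℕ} :
    p.val ∈ (T.toPMap.restrict (real R)).domIter n ↔ ∀ k < n, (hat hT)^[k] p ∈ R := by
  refine forall₂_congr fun k _ => ?_
  rw [dom_restrict hT, ← val_mem_real ((right_iterate_hat k p).trans hp), val_iterate_hat hp]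
  rfl

/-- The points of the backward orbit. -/
theorem mem_domIter_and_iterate_eq (hT : T.IsGIET) (hp : p.right = true) {n : ℕ} {y : ℝ} :
    (y ∈ (T.toPMap.restrict (real R)).domIter n ∧
      (T.toPMap.restrict (real R)).toFun^[n] y = p.val) ↔
    y = ((hat hT).symm^[n] p).val ∧ ∀ k, 0 < k → k ≤ n → (hat hT).symm^[k] p ∈ R := by
  constructor
  · rintro ⟨hy, hyp⟩
    rcases n.eq_zero_or_pos with rfl | hn
    · exact ⟨hyp, fun k h1 h2 => absurd h1 (by omega)⟩
    have hy0 := hy 0 hn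
    rw [dom_restrict hT] at hy0
    obtain ⟨s, hs, hsr, rfl⟩ := exists_of_mem_real hy0
    have hs' : (hat hT)^[n] s = p := DArrow.ext ((val_iterate_hat hsr n).trans hyp)
      ((right_iterate_hat n s).trans (hsr.trans hp.symm))
    rw [val_mem_domIter hT hsr] at hy
    rw [← hs', symm_iterate_iterate]
    refine ⟨rfl, fun k h1 h2 => ?_⟩
    have := iterate_symm_iterate_of_ge (hat hT).symm h2 s
    rw [symm_symm] at this
    rw [this]
    exact hy _ (by omega)
  · rintro ⟨rfl, h⟩
    have hr : ((hat hT).symm^[n] p).right = true := (right_symm_iterate_hat n p).trans hp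
    constructor
    · rw [val_mem_domIter hT hr]
      intro k hk
      rw [iterate_symm_iterate_of_ge _ hk.le]
      exact h _ (by omega) (by omega)
    · change T.toFun^[n] _ = _
      rw [← val_iterate_hat hr (hT := hT), iterate_symm_iterate]

theorem val_mem_range (hT : T.IsGIET) (hp : p.right = true) :
    p.val ∈ (T.toPMap.restrict (real R)).range ↔ (hat hT).symm p ∈ R := by
  have h := fun y => mem_domIter_and_iterate_eq (R := R) hT hp (n := 1) (y := y)
  constructor
  · rintro ⟨y, hy, hyp⟩
    exact ((h y).1 ⟨fun k hk => by rwa [Nat.lt_one_iff.1 hk], hyp⟩).2 1 one_pos le_rfl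
  · intro hR
    obtain ⟨h1, h2⟩ := (h _).2 ⟨rfl, fun k h1 h2 => by rwa [le_antisymm h2 h1]⟩
    exact ⟨_, h1 0 one_pos, h2⟩

theorem isDomainOfTransition (hT : T.IsGIET) {D : Set DArrow} (h : ∀ x, ∃ n, (hat hT)^[n] x ∉ D)
    (h' : ∀ x, ∃ n, (hat hT).symm^[n] x ∉ D) : T.toPMap.IsDomainOfTransition (real D) := by
  classical
  intro x hx
  obtain ⟨p, hpD, hp, rfl⟩ := exists_of_mem_real hx
  constructor
  · refine ⟨Nat.find (h p), ?_, ?_⟩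
    · rw [val_mem_domIter hT hp]
      exact fun k hk => not_not.1 (Nat.find_min (h p) hk)
    · rw [dom_restrict hT]
      change T.toFun^[_] _ ∉ _
      rw [← val_iterate_hat hp (hT := hT), val_mem_real ((right_iterate_hat _ p).trans hp)]
      exact Nat.find_spec (h p)
  -- The first backward exit is at `m ≥ 1`. The point at time `-(m - 1)` is still in `D` but has no
  -- preimage there, so it is the one outside the range.
  · set m := Nat.find (h' p) with hm
    have hm0 : m ≠ 0 := fun h0 => by
      have := Nat.find_spec (h' p)
      rw [← hm, h0] at this
      exact this hpD
    obtain ⟨h1, h2⟩ := (mem_domIter_and_iterate_eq (R := D) hT hp (n := m - 1)).2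
      ⟨rfl, fun k _ hk => not_not.1 (Nat.find_min (h' p) (by omega))⟩
    refine ⟨m - 1, _, h1, h2, ?_⟩
    rw [val_mem_range hT ((right_symm_iterate_hat _ p).trans hp), ← iterate_succ_apply' (hat hT).symm,
      Nat.succ_eq_add_one, Nat.sub_add_cancel (Nat.one_le_iff_ne_zero.2 hm0)]
    exact Nat.find_spec (h' p)

theorem isDomainOfRecurrence (hR : IsRegion (hat hT) R C) :
    T.toPMap.IsDomainOfRecurrence (real R) := by
  rintro x hx ⟨⟨n, -, hn⟩, m, y, hy, hyx, hm⟩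
  obtain ⟨p, hpR, hp, rfl⟩ := exists_of_mem_real hx
  rcases hR.stays p hpR with ⟨h, -⟩ | ⟨h, -⟩
  · rw [dom_restrict hT] at hn
    change T.toFun^[_] _ ∉ _ at hn
    rw [← val_iterate_hat hp (hT := hT), val_mem_real ((right_iterate_hat _ p).trans hp)] at hn
    exact hn (h n)
  · obtain ⟨rfl, -⟩ := (mem_domIter_and_iterate_eq hT hp).1 ⟨hy, hyx⟩
    rw [val_mem_range hT ((right_symm_iterate_hat _ p).trans hp), ← iterate_succ_apply' (hat hT).symm] at hm
    exact hm (h _)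

/-- A recurrent orbit of the restriction stays in the region, and returns near its starting
point on one of the two sides. -/
theorem exists_of_isRecurrent (hT : T.IsGIET) {x : ℝ}
    (hx : (T.toPMap.restrict (real R)).IsRecurrent x) :
    ∃ p : DArrow, p.right = true ∧ p.val = x ∧ (∀ n, (hat hT)^[n] p ∈ R) ∧
      (∀ n, (hat hT).symm^[n] p ∈ R) ∧ (∃ p', p'.val = x ∧ p' ∈ (hat hT).omegaSet p) ∧
      ∃ p', p'.val = x ∧ p' ∈ (hat hT).symm.omegaSet p := by
  obtain ⟨⟨hf, hω⟩, hb, hα⟩ := hx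
  have hx0 := hω.1
  rw [dom_restrict hT] at hx0
  obtain ⟨p, hpR, hp, rfl⟩ := exists_of_mem_real hx0
  have hfwd : ∀ n, ∀ k < n, (hat hT)^[k] p ∈ R := by
    intro n
    induction n with
    | zero => exact fun k hk => absurd hk (by omega)
    | succ n ih =>
      intro k hk
      rcases Nat.lt_succ_iff_lt_or_eq.1 hk with h | rfl
      · exact ih k h
      · have := (hf ⟨k, (val_mem_domIter hT hp).2 ih, rfl⟩).1
        rw [dom_restrict hT] at this
        change T.toFun^[_] _ ∈ _ at this
        rwa [← val_iterate_hat hp (hT := hT),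
          val_mem_real ((right_iterate_hat _ p).trans hp)] at this
  have hbwd : ∀ n, (hat hT).symm^[n] p ∈ R := by
    have : ∀ n, ∀ k ≤ n, (hat hT).symm^[k] p ∈ R := by
      intro n
      induction n with
      | zero => exact fun k hk => by rwa [Nat.le_zero.1 hk]
      | succ n ih =>
        intro k hk
        rcases Nat.le_succ_iff.1 hk with h | rfl
        · exact ih k h
        · have h1 := (mem_domIter_and_iterate_eq (R := R) hT hp).2 ⟨rfl, fun k _ => ih k⟩
          have h2 := (hb ⟨n, h1⟩).2
          rwa [val_mem_range hT ((right_symm_iterate_hat _ p).trans hp),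
            ← iterate_succ_apply' (hat hT).symm] at h2
    exact fun n => this n n le_rfl
  refine ⟨p, hp, rfl, fun n => hfwd (n + 1) n n.lt_succ_self, hbwd,
    exists_mem_omegaSet_of_val fun U hU N => ?_, exists_mem_omegaSet_of_val fun U hU N => ?_⟩
  · obtain ⟨n, hn, -, h⟩ := hω.2 U hU N
    refine ⟨n, hn, ?_⟩
    rw [val_iterate_hat hp]
    exact h
  · obtain ⟨n, hn, z, hz, h⟩ := hα.2 U hU N
    refine ⟨n, hn, ?_⟩
    rwa [← ((mem_domIter_and_iterate_eq hT hp).1 h).1]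

theorem injOn_restrict (hT : T.IsGIET) :
    InjOn (T.toPMap.restrict (real R)).toFun (T.toPMap.restrict (real R)).dom := by
  rw [dom_restrict hT]
  intro x hx y hy hxy
  obtain ⟨p, -, hp, rfl⟩ := exists_of_mem_real hx
  obtain ⟨s, -, hs, rfl⟩ := exists_of_mem_real hy
  have : hat hT p = hat hT s := DArrow.ext
    (by rw [val_hat_of_right hp, val_hat_of_right hs]; exact hxy) (hp.trans hs.symm)
  rw [(hat hT).injective this]

/-! ### Periodic regions -/

theorem injOn_val_iterate {q : ℕ} (hp : minimalPeriod (hat hT) p = q) :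
    InjOn (fun k => ((hat hT)^[k] p).val) (Iio q) := by
  intro k hk l hl h
  have : (hat hT)^[k] p = (hat hT)^[l] p :=
    DArrow.ext h ((right_iterate_hat k p).trans (right_iterate_hat l p).symm)
  rw [← hp] at hk hl
  exact (iterate_eq_iterate_iff_of_lt_minimalPeriod hk hl).1 this

theorem iterate_add_minimalPeriod {q : ℕ} (hp : minimalPeriod (hat hT) p = q) (k : ℕ) :
    (hat hT)^[k + q] p = (hat hT)^[k] p := by
  rw [iterate_add_apply, ← hp, iterate_minimalPeriod]

theorem isPeriodicOfPeriod_of_right {q : ℕ} (hq : 0 < q) (hR : IsRegion (hat hT) R C)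
    (hpR : p ∈ R) (hp : p.right = true) (hper : minimalPeriod (hat hT) p = q) :
    (T.toPMap.restrict (real R)).IsPeriodicOfPeriod q p.val := by
  refine PMap.isPeriodicOfPeriod_of_seq (injOn_restrict hT)
    (a := fun k => ((hat hT)^[k] p).val) hq (fun k => ?_) (fun k => ?_) (fun k => ?_)
    (injOn_val_iterate hper)
  · rw [dom_restrict hT, val_mem_real ((right_iterate_hat _ p).trans hp)]
    exact hR.iterate_mem_of_periodic hq (hper ▸ isPeriodicPt_minimalPeriod _ p) hpR k
  · change T.toFun _ = _
    rw [iterate_succ_apply', val_hat_of_right ((right_iterate_hat _ p).trans hp)]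
  · simp only [iterate_add_minimalPeriod hper]

theorem mem_leftOpen_dom (hT : T.IsGIET) (hR : IsClopen R) {y : ℝ} :
    y ∈ (T.toPMap.restrict (real R)).leftOpen.dom ↔ ∃ p ∈ R, p.right = false ∧ p.val = y := by
  change (∀ᶠ z in 𝓝[<] y, z ∈ (T.toPMap.restrict (real R)).dom) ↔ _
  rw [dom_restrict hT, ← minus_mem_iff hR]
  constructor
  · rintro ⟨h, hy⟩
    exact ⟨_, hy, rfl, rfl⟩
  · rintro ⟨p, hpR, hp, rfl⟩
    rcases p.eq_plus_or_eq_minus with ⟨h, he⟩ | ⟨h, he⟩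
    · rw [he] at hp
      exact absurd hp (by simp)
    · exact ⟨h, he ▸ hpR⟩

theorem injOn_leftOpen (hT : T.IsGIET) (hR : IsClopen R) :
    InjOn (T.toPMap.restrict (real R)).leftOpen.toFun
      (T.toPMap.restrict (real R)).leftOpen.dom := by
  intro x hx y hy hxy
  obtain ⟨p, -, hp, rfl⟩ := (mem_leftOpen_dom hT hR).1 hx
  obtain ⟨s, -, hs, rfl⟩ := (mem_leftOpen_dom hT hR).1 hy
  have : hat hT p = hat hT s := DArrow.ext
    (by rw [val_hat_of_left hp, val_hat_of_left hs]; exact hxy) (hp.trans hs.symm)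
  rw [(hat hT).injective this]

/-- A periodic orbit of left points is one of the left-open map. If it meets no right endpoint, `T`
is continuous along it, left limits are values, and it is a periodic orbit of the restriction
itself. -/
theorem exists_isPeriodicOfPeriod_of_left {q : ℕ} (hq : 0 < q) (hR : IsRegion (hat hT) R C)
    (hpR : p ∈ R) (hp : p.right = false) (hper : minimalPeriod (hat hT) p = q) :
    (∃ x, (T.toPMap.restrict (real R)).IsPeriodicOfPeriod q x) ∨
      ∃ y, (T.toPMap.restrict (real R)).IsPeriodicAtRightEndpoint q y := by
  set a : ℕ → ℝ := fun k => ((hat hT)^[k] p).val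
  have hmem : ∀ k, (hat hT)^[k] p ∈ R :=
    hR.iterate_mem_of_periodic hq (hper ▸ isPeriodicPt_minimalPeriod _ p) hpR
  have hright : ∀ k, ((hat hT)^[k] p).right = false := fun k => (right_iterate_hat k p).trans hp
  have hdom : ∀ k, a k ∈ (T.toPMap.restrict (real R)).leftOpen.dom := fun k =>
    (mem_leftOpen_dom hT hR.isClopen).2 ⟨_, hmem k, hright k, rfl⟩
  have hstep : ∀ k, leftLim T.toFun (a k) = a (k + 1) := fun k => by
    simp only [a, iterate_succ_apply', val_hat_of_left (hright k)]
  have hadd : ∀ k, a (k + q) = a k := fun k => by simp only [a, iterate_add_minimalPeriod hper]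
  have hiter : ∀ n, (leftLim T.toFun)^[n] (a 0) = a n := by
    intro n
    induction n with
    | zero => rfl
    | succ n ih => rw [iterate_succ_apply', ih, hstep]
  by_cases hend : ∃ k, (T.toPMap.restrict (real R)).IsRightEndpoint (a k)
  · obtain ⟨k, hk⟩ := hend
    refine Or.inr ⟨a 0, PMap.isPeriodicOfPeriod_of_seq (injOn_leftOpen hT hR.isClopen) hq hdom hstep
      hadd (injOn_val_iterate hper), a k, Or.inl ⟨k, fun j _ => ?_, hiter k⟩, hk⟩
    change (leftLim T.toFun)^[j] (a 0) ∈ _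
    rw [hiter]
    exact hdom j
  · push Not at hend
    have hgood : ∀ k, (T.toPMap.restrict (real R)).dom ∈ 𝓝 (a k) ∧ ContinuousAt T.toFun (a k) :=
      fun k => by
        by_contra h
        exact hend k ⟨hdom k, h⟩
    refine Or.inl ⟨a 0, PMap.isPeriodicOfPeriod_of_seq (injOn_restrict hT) hq
      (fun k => mem_of_mem_nhds (hgood k).1) (fun k => ?_) hadd (injOn_val_iterate hper)⟩
    rw [← hstep k]
    exact (leftLim_eq_of_tendsto ((hgood k).2.tendsto.mono_left nhdsWithin_le_nhds)).symm

/-- A point which returns to itself on one side in the future and in the past, with periodic limit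
points, is periodic. -/
theorem minimalPeriod_eq_of_omegaSet_subset {F : DArrow ≃ₜ DArrow} (hF : F.IsPiecewiseMono)
    (hright : ∀ n p, (F^[n] p).right = p.right) {q : ℕ} (hq : 0 < q) {p₁ p₂ : DArrow}
    (h1 : p₁.val = p.val) (h2 : p₂.val = p.val) (hω : p₁ ∈ F.omegaSet p)
    (hα : p₂ ∈ F.symm.omegaSet p) (hsub : F.omegaSet p ⊆ {y | minimalPeriod F y = q}) :
    minimalPeriod F p = q := by
  by_cases hp1 : p₁.right = p.right
  · rw [DArrow.ext h1 hp1] at hω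
    exact hsub hω
  -- Now `p₁` is the twin of `p`. Either `p₂ = p`, and the past limit set, closed and invariant,
  -- contains the orbit of `p` and hence its future limit points; or `p₂` is the same twin.
  have hα1 : p₁ ∈ F.symm.omegaSet p := by
    by_cases hp2 : p₂.right = p.right
    · rw [DArrow.ext h2 hp2] at hα
      exact omegaSet_subset_of_forall_mem isClosed_omegaSet
        (symm_iterate_mem_omegaSet (T := F.symm) hα) hω
    · have : p₁ = p₂ := DArrow.ext (h1.trans h2.symm) (by
        revert hp1 hp2
        cases p₁.right <;> cases p₂.right <;> cases p.right <;> simp)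
      rwa [this]
  have hper : IsPeriodicPt F q p₁ := by
    have h := isPeriodicPt_minimalPeriod F p₁
    rwa [show minimalPeriod F p₁ = q from hsub hω] at h
  -- A periodic point that is a limit in both directions lies on the orbit of `p`, whereas iterates
  -- of `p` remain on the side of `p`.
  obtain ⟨n, hn⟩ := hF.exists_iterate_eq isOpen_Ici_or_isOpen_Iic hq hper hω hα1
  exact absurd (by rw [← hn, hright]) hp1

theorem isPeriodicType {q : ℕ} (hq : 0 < q)
    (hR : IsRegion (hat hT) R {y | minimalPeriod (hat hT) y = q})
    (hne : (R ∩ {y | minimalPeriod (hat hT) y = q}).Nonempty) :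
    (T.toPMap.restrict (real R)).IsPeriodicType := by
  refine ⟨q, ?_, fun x hx => ?_⟩
  · obtain ⟨p, hpR, hper⟩ := hne
    rcases hp : p.right with _ | _
    · exact exists_isPeriodicOfPeriod_of_left hq hR hpR hp hper
    · exact Or.inl ⟨_, isPeriodicOfPeriod_of_right hq hR hpR hp hper⟩
  · obtain ⟨p, hp, rfl, hf, -, ⟨p₁, h1, hω⟩, p₂, h2, hα⟩ := exists_of_isRecurrent hT hx
    refine isPeriodicOfPeriod_of_right hq hR (hf 0) hp ?_
    rcases hR.stays p (hf 0) with ⟨-, hsub⟩ | ⟨-, hsub⟩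
    · exact minimalPeriod_eq_of_omegaSet_subset (isPiecewiseMono_hat hT) right_iterate_hat hq
        h1 h2 hω hα hsub
    · rw [← minimalPeriod_symm]
      simp only [← minimalPeriod_symm (T := hat hT)] at hsub
      exact minimalPeriod_eq_of_omegaSet_subset (isPiecewiseMono_hat hT).symm
        right_symm_iterate_hat hq h2 h1 hα hω hsub

/-! ### Quasiminimal regions -/

theorem orbit_eq (hp : p.right = true) (hf : ∀ n, (hat hT)^[n] p ∈ R)
    (hb : ∀ n, (hat hT).symm^[n] p ∈ R) :
    (T.toPMap.restrict (real R)).orbit p.val =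
      val '' (range (fun n => (hat hT)^[n] p) ∪ range fun n => (hat hT).symm^[n] p) := by
  rw [image_union, ← range_comp, ← range_comp]
  refine congrArg₂ (· ∪ ·) ?_ ?_
  · ext y
    constructor
    · rintro ⟨n, -, rfl⟩
      exact ⟨n, val_iterate_hat hp n⟩
    · rintro ⟨n, rfl⟩
      exact ⟨n, (val_mem_domIter hT hp).2 fun k _ => hf k, (val_iterate_hat hp n).symm⟩
  · ext y
    constructor
    · rintro ⟨n, hn⟩
      exact ⟨n, ((mem_domIter_and_iterate_eq hT hp).1 hn).1.symm⟩
    · rintro ⟨n, rfl⟩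
      exact ⟨n, (mem_domIter_and_iterate_eq hT hp).2 ⟨rfl, fun k _ _ => hb k⟩⟩

/-- The point `u` of `M` has the same real orbit as `p`, the orbit of `u` is dense in `M`, and `val`
is a closed continuous map. -/
theorem closure_orbit_restrict {M : Set DArrow} (hM : IsMinimalSet (hat hT) M)
    (hp : p.right = true) (hf : ∀ n, (hat hT)^[n] p ∈ R) (hb : ∀ n, (hat hT).symm^[n] p ∈ R)
    {u : DArrow} (hu : u ∈ M) (huf : ∀ n, ((hat hT)^[n] u).val = ((hat hT)^[n] p).val)
    (hub : ∀ n, ((hat hT).symm^[n] u).val = ((hat hT).symm^[n] p).val) :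
    closure ((T.toPMap.restrict (real R)).orbit p.val) = val '' M := by
  have : val '' (range (fun n => (hat hT)^[n] p) ∪ range fun n => (hat hT).symm^[n] p) =
      val '' (range (fun n => (hat hT)^[n] u) ∪ range fun n => (hat hT).symm^[n] u) := by
    simp only [image_union, ← range_comp]
    exact congrArg₂ _ (congrArg range (funext fun n => (huf n).symm))
      (congrArg range (funext fun n => (hub n).symm))
  rw [orbit_eq hp hf hb, this, continuous_val.isClosedMap.closure_image_eq_of_continuous
    continuous_val, closure_orbit_eq hM hu]

theorem not_isPeriodic_of_notMem_periodicPts (hp : p.right = true)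
    (hf : ∀ n, (hat hT)^[n] p ∈ R) (hper : p ∉ periodicPts (hat hT)) :
    ¬ (T.toPMap.restrict (real R)).IsPeriodic p.val := by
  rintro ⟨-, hfin⟩
  refine infinite_range_of_injective (f := fun n => ((hat hT)^[n] p).val) (fun m n h => ?_)
    (hfin.subset ?_)
  · exact iterate_injective_of_notMem_periodicPts hper
      (DArrow.ext h ((right_iterate_hat m p).trans (right_iterate_hat n p).symm))
  · rintro _ ⟨n, rfl⟩
    exact Or.inl ⟨n, (val_mem_domIter hT hp).2 fun k _ => hf k, (val_iterate_hat hp n).symm⟩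

theorem isNontriviallyRecurrent_of_mem {M : Set DArrow} (hM : IsAperiodicMinimal (hat hT) M)
    (hMR : M ⊆ R) (hpM : p ∈ M) (hp : p.right = true) :
    (T.toPMap.restrict (real R)).IsNontriviallyRecurrent p.val := by
  have hf : ∀ n, (hat hT)^[n] p ∈ R := fun n => hMR (hM.1.mapsTo.iterate n hpM)
  have hb : ∀ n, (hat hT).symm^[n] p ∈ R := fun n => hMR (hM.1.symm_mapsTo.iterate n hpM)
  have horb : (T.toPMap.restrict (real R)).orbit p.val ⊆
      (T.toPMap.restrict (real R)).dom ∩ (T.toPMap.restrict (real R)).range := by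
    rw [orbit_eq hp hf hb]
    have key : ∀ s ∈ M, s.right = true → s.val ∈
        (T.toPMap.restrict (real R)).dom ∩ (T.toPMap.restrict (real R)).range := fun s hs hsr =>
      ⟨by rw [dom_restrict hT, val_mem_real hsr]; exact hMR hs,
        (val_mem_range hT hsr).2 (hMR (hM.1.symm_mapsTo hs))⟩
    rintro _ ⟨_, ⟨n, rfl⟩ | ⟨n, rfl⟩, rfl⟩
    · exact key _ (hM.1.mapsTo.iterate n hpM) ((right_iterate_hat n p).trans hp)
    · exact key _ (hM.1.symm_mapsTo.iterate n hpM) ((right_symm_iterate_hat n p).trans hp)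
  have hdom : p.val ∈ (T.toPMap.restrict (real R)).dom := by
    rw [dom_restrict hT, val_mem_real hp]
    exact hMR hpM
  refine ⟨⟨⟨fun y hy => horb (Or.inl hy), hdom, fun U hU N => ?_⟩,
    fun y hy => horb (Or.inr hy), hdom, fun U hU N => ?_⟩,
    not_isPeriodic_of_notMem_periodicPts hp hf (hM.2 p hpM)⟩
  · have h : p ∈ (hat hT).omegaSet p := by rwa [hM.1.omegaSet_eq hpM]
    obtain ⟨n, hn, h'⟩ := mem_omegaSet_iff.1 h _ (continuous_val.continuousAt hU) N
    exact ⟨n, hn, (val_mem_domIter hT hp).2 fun k _ => hf k, by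
      rw [mem_preimage, val_iterate_hat hp] at h'; exact h'⟩
  · have h : p ∈ (hat hT).symm.omegaSet p := by rwa [hM.1.symm.omegaSet_eq hpM]
    obtain ⟨n, hn, h'⟩ := mem_omegaSet_iff.1 h _ (continuous_val.continuousAt hU) N
    exact ⟨n, hn, _, h', (mem_domIter_and_iterate_eq hT hp).2 ⟨rfl, fun k _ _ => hb k⟩⟩

/-- Every recurrent orbit of the restriction has closure `val '' M`, which gives uniqueness; a right
point of `M` gives existence. -/
theorem isQuasiminimalType {M : Set DArrow} (hM : IsAperiodicMinimal (hat hT) M)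
    (hR : IsRegion (hat hT) R M) (hfol : FollowsLeft (hat hT) R M) (hne : (R ∩ M).Nonempty) :
    (T.toPMap.restrict (real R)).IsQuasiminimalType := by
  have hMR : M ⊆ R := hR.subset_of_inter_nonempty hM.1 hne
  have hclos : ∀ x, (T.toPMap.restrict (real R)).IsRecurrent x →
      closure ((T.toPMap.restrict (real R)).orbit x) = val '' M ∧
        ¬ (T.toPMap.restrict (real R)).IsPeriodic x := by
    intro x hx
    obtain ⟨p, hp, rfl, hf, hb, ⟨p₁, h1, hω⟩, p₂, h2, hα⟩ := exists_of_isRecurrent hT hx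
    have hper : p ∉ periodicPts (hat hT) := by
      rintro ⟨n, hn, h⟩
      refine (hR.stays p (hf 0)).elim (fun h' => ?_) fun h' => ?_
      · exact hM.2 p (h'.2 (mem_omegaSet_of_periodic hn h)) ⟨n, hn, h⟩
      · exact hM.2 p (h'.2 (mem_omegaSet_of_periodic hn (isPeriodicPt_symm.2 h))) ⟨n, hn, h⟩
    refine ⟨?_, not_isPeriodic_of_notMem_periodicPts hp hf hper⟩
    -- One of the limit points over `p.val` lies in `M`. If it is not `p`, it is the left twin of
    -- `p`, and `FollowsLeft` keeps the two orbits equal on the line.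
    obtain ⟨u, huM, hup⟩ : ∃ u ∈ M, u.val = p.val :=
      (hR.stays p (hf 0)).elim (fun h' => ⟨p₁, h'.2 hω, h1⟩) fun h' => ⟨p₂, h'.2 hα, h2⟩
    by_cases hpM : p ∈ M
    · exact closure_orbit_restrict hM.1 hp hf hb hpM (fun _ => rfl) fun _ => rfl
    · have hur : u.right = false := by
        by_contra h
        refine hpM ?_
        rwa [DArrow.ext hup (((Bool.not_eq_false _).mp h).trans hp.symm)] at huM
      have hcov : u ⋖ p := by
        rcases u.eq_plus_or_eq_minus with ⟨h, he⟩ | ⟨h, he⟩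
        · rw [he] at hur
          exact absurd hur (by simp)
        rcases p.eq_plus_or_eq_minus with ⟨h', he'⟩ | ⟨h', he'⟩
        · rw [he, he']
          simp only [hup]
          exact minus_covBy_plus _ _
        · rw [he'] at hp
          exact absurd hp (by simp)
      have := hfol p u hf hb hpM huM hcov
      exact closure_orbit_restrict hM.1 hp hf hb huM (fun n => val_eq_of_covBy (this n).1)
        fun n => val_eq_of_covBy (this n).2
  -- The least point of `M` is a right point: otherwise its open lower ray would isolate it in `M`.
  obtain ⟨m, hm⟩ := hM.1.isClosed.isCompact.exists_isLeast hM.1.nonempty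
  have hmr : m.right = true := by
    by_contra h
    rw [Bool.not_eq_true] at h
    obtain ⟨y, hy, hne⟩ := hM.1.exists_ne_mem hM.2 hm.1
      ((DArrow.isOpen_Iic_of_left h).mem_nhds self_mem_Iic)
    exact hne (le_antisymm hy.1 (hm.2 hy.2))
  have hrec := isNontriviallyRecurrent_of_mem (T := T) hM hMR hm.1 hmr
  refine ⟨⟨_, ⟨m.val, hrec, rfl⟩, ?_⟩, fun x hx => ⟨hx, (hclos x hx).2⟩⟩
  rintro _ ⟨x, hx, rfl⟩
  rw [(hclos x hx.1).1, (hclos _ hrec.1).1]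

end GGIET

/-! ### Transfer of the decomposition to the interval. -/

theorem theorem1p1 {r : WithTop ℕ∞} {d : ℕ} (T : GGIET r d) (hT : T.IsGIET) :
    ∃ (k : ℕ) (D : Set ℝ) (R : Fin k → Set ℝ),
      IsRightOpenUnion D ∧ (∀ i, IsRightOpenUnion (R i)) ∧
      D ∪ (⋃ i, R i) = Set.Ico 0 1 ∧
      (∀ i, Disjoint D (R i)) ∧
      (Pairwise fun i j => Disjoint (R i) (R j)) ∧
      T.toPMap.IsDomainOfTransition D ∧
      ∀ i, T.toPMap.IsDomainOfRecurrence (R i) ∧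
        Xor (T.toPMap.restrict (R i)).IsPeriodicType
          (T.toPMap.restrict (R i)).IsQuasiminimalType := by
  obtain ⟨k, C, R, hC, hreg, hne, hdisj, h1, h2⟩ :=
    (GGIET.isPiecewiseMono_hat hT).exists_decomposition DArrow.isOpen_Ici_or_isOpen_Iic
  have hclopen : IsClopen (⋃ i, R i) := isClopen_iUnion_of_finite fun i => (hreg i).isClopen
  have hreal : ∀ {K K' : Set DArrow}, Disjoint K K' → Disjoint (DArrow.real K) (DArrow.real K') :=
    fun h => Set.disjoint_left.2 fun x ⟨_, hx⟩ ⟨_, hx'⟩ => Set.disjoint_left.1 h hx hx'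
  refine ⟨k, DArrow.real (⋃ i, R i)ᶜ, fun i => DArrow.real (R i),
    DArrow.isRightOpenUnion_real hclopen.compl,
    fun i => DArrow.isRightOpenUnion_real (hreg i).isClopen, ?_,
    fun i => hreal (disjoint_compl_left_iff_subset.2 (subset_iUnion R i)),
    fun i j hij => hreal (hdisj hij), ?_,
    fun i => ⟨GGIET.isDomainOfRecurrence (hreg i), ?_⟩⟩
  · ext x
    constructor
    · rintro (⟨h, -⟩ | hx)
      · exact h
      · obtain ⟨i, h, -⟩ := mem_iUnion.1 hx
        exact h
    · intro hx
      by_cases hp : DArrow.plus x hx ∈ ⋃ i, R i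
      · obtain ⟨i, hi⟩ := mem_iUnion.1 hp
        exact Or.inr (mem_iUnion.2 ⟨i, hx, hi⟩)
      · exact Or.inl ⟨hx, hp⟩
  · exact GGIET.isDomainOfTransition hT (fun x => (h1 x).imp fun n hn => not_not.2 hn)
      fun x => (h2 x).imp fun n hn => not_not.2 hn
  · rcases hC i with ⟨q, hq, hCq⟩ | ⟨hM, hfol⟩
    · have hr := hreg i
      have hn := hne i
      rw [hCq] at hr hn
      have hper := GGIET.isPeriodicType hq hr hn
      refine Or.inl ⟨hper, ?_⟩
      -- The types exclude each other: a quasiminimal comes from a recurrent orbit that is not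
      -- periodic.
      rintro ⟨⟨_, ⟨x, hx, -⟩, -⟩, -⟩
      obtain ⟨q', -, hall⟩ := hper
      exact hx.2 (hall x hx.1).1
    · have hqm := GGIET.isQuasiminimalType hM (hreg i) hfol (hne i)
      refine Or.inr ⟨hqm, ?_⟩
      rintro ⟨q', -, hall⟩
      obtain ⟨⟨_, ⟨x, hx, -⟩, -⟩, -⟩ := hqm
      exact hx.2 (hall x hx.1).1
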